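/- For $n\ge 1$ let $R_n\subset\mathbb{R}^n$ be the convex hull of the $n$ columns of the upper triangular $n\times n$ matrix whose entries above the diagonal are all $1$, whose entries below the diagonal are all $0$, and whose diagonal is $(1,\,n-1,\,n-2,\,\dots,\,2,\,1)$, i.e. its first diagonal entry is $1$ and its $k$-th diagonal entry is $n-k+1$ for $2\le k\le n$. Let $$L_n=\Big\{\lambda\in\mathbb{R}^n:\ 0\le \frac{\lambda_1}{1}\le\frac{\lambda_2}{2}\le\cdots\le\frac{\lambda_n}{n}\Big\}$$ be the lecture hall cone, and put $\deg(\lambda)=\lambda_n-\lambda_{n-1}$ (with $\lambda_0=0$). A triangulation of a polytope (respectively, of a polyhedral cone) is a finite simplicial complex (respectively, a finite simplicial fan) whose union is the given polytope (cone). It is *regular* if there is a convex real-valued function on the polytope (cone) whose domains of linearity, i.e. the maximal convex subsets on which it agrees with an affine function, are exactly the maximal simplices (maximal cones). It is *flag* if every minimal non-face of the corresponding abstract simplicial complex, on the set of vertices (rays), has exactly two elements. A triangulation of a lattice polytope $P\subset\mathbb{R}^n$ is *unimodular* if every maximal simplex has vertices $v_0,\dots,v_d\in\mathbb{Z}^n$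 such that $v_1-v_0,\dots,v_d-v_0$ is a lattice basis of $\mathbb{Z}^n\cap W$, where $W$ is the linear space parallel to the affine hull of $P$. A triangulation of a cone $C\subset\mathbb{R}^n$ is *unimodular* if every maximal cone is generated by a lattice basis of $\mathbb{Z}^n\cap\operatorname{span}_{\mathbb{R}}(C)$. **Theorem.** For every $n\ge 1$, the simplex $R_n$ admits a regular, flag, unimodular triangulation. Consequently, the lecture hall cone $L_n$ admits a regular, flag, unimodular triangulation; moreover one all of whose rays are generated by lattice points of degree $1$. -/

import Mathlib

namespace LectureHall

/-! ### Lattices and lattice bases -/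

/-- The lattice `ℤⁿ` inside `ℝⁿ`. -/
def integerLattice (n : ℕ) : Submodule ℤ (Fin n → ℝ) where
  carrier := {v | ∀ i, ∃ z : ℤ, (z : ℝ) = v i}
  zero_mem' := fun _ => ⟨0, by simp⟩
  add_mem' := by
    intro a b ha hb i
    obtain ⟨x, hx⟩ := ha i
    obtain ⟨y, hy⟩ := hb i
    exact ⟨x + y, by simp [hx, hy]⟩
  smul_mem' := by
    intro c a ha i
    obtain ⟨x, hx⟩ := ha i
    exact ⟨c * x, by simp [hx]⟩

/-- The lattice `ℤⁿ ∩ W` of integer points of a linear subspace `W` of `ℝⁿ`. -/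
def latticeOf {n : ℕ} (W : Submodule ℝ (Fin n → ℝ)) : Submodule ℤ (Fin n → ℝ) :=
  integerLattice n ⊓ W.restrictScalars ℤ

/-- `b` is a `ℤ`-basis of the lattice `Λ`. -/
def IsLatticeBasis {n : ℕ} (Λ : Submodule ℤ (Fin n → ℝ)) (b : Set (Fin n → ℝ)) : Prop :=
  LinearIndepOn ℤ id b ∧ Submodule.span ℤ b = Λ

/-! ### Regularity and flagness -/

/-- `D` is a domain of linearity of `f` on `P`: an inclusion-maximal convex subset of `P` on which
`f` coincides with an affine function. -/
def IsLinearityDomain {E : Type*} [AddCommGroup E] [Module ℝ E]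
    (P : Set E) (f : E → ℝ) (D : Set E) : Prop :=
  Maximal (fun D : Set E => D ⊆ P ∧ Convex ℝ D ∧ ∃ g : E →ᵃ[ℝ] ℝ, Set.EqOn f g D) D

/-- A collection of cells in `P` is regular if there is a convex function on `P` whose domains of
linearity are exactly the given cells. -/
def IsRegular {E : Type*} [AddCommGroup E] [Module ℝ E]
    (P : Set E) (cells : Set (Set E)) : Prop :=
  ∃ f : E → ℝ, ConvexOn ℝ P f ∧ {D | IsLinearityDomain P f D} = cells

/-- `s` is a minimal non-face of the family `faces` of finite sets: `s` is a nonempty set of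
vertices that is not a face, while each of its nonempty proper subsets is a face. -/
def IsMinimalNonface {E : Type*} (faces : Set (Finset E)) (s : Finset E) : Prop :=
  s.Nonempty ∧ (∀ v ∈ s, {v} ∈ faces) ∧ s ∉ faces ∧ ∀ t ⊂ s, t.Nonempty → t ∈ faces

/-- All minimal non-faces are pairs of vertices. -/
def IsFlag {E : Type*} (faces : Set (Finset E)) : Prop :=
  ∀ s, IsMinimalNonface faces s → s.card = 2

/-! ### Triangulations of polytopes -/

/-- The finite geometric simplicial complex `K` is a triangulation of `P`. -/
def IsTriangulation {n : ℕ} (K : Geometry.SimplicialComplex ℝ (Fin n → ℝ))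
    (P : Set (Fin n → ℝ)) : Prop :=
  K.faces.Finite ∧ K.space = P

/-- The simplex with vertex set `s` has integer vertices, and the differences `v - v₀` of its
vertices with one of them form a lattice basis of `ℤⁿ ∩ W`.  If `W` is the direction of the
affine hull of a polytope `P`, these are the full-dimensional unimodular simplices for `P`. -/
def IsUnimodularSimplex {n : ℕ} (W : Submodule ℝ (Fin n → ℝ)) (s : Finset (Fin n → ℝ)) : Prop :=
  (∀ v ∈ s, v ∈ integerLattice n) ∧
    ∃ v₀ ∈ s, IsLatticeBasis (latticeOf W) ((fun v => v - v₀) '' ((s : Set (Fin n → ℝ)) \ {v₀}))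

/-- `P` has a regular, flag, unimodular triangulation (unimodular with respect to the lattice of
the affine hull of `P`). -/
def HasRegularFlagUnimodularTriangulation {n : ℕ} (P : Set (Fin n → ℝ)) : Prop :=
  ∃ K : Geometry.SimplicialComplex ℝ (Fin n → ℝ), IsTriangulation K P ∧
    IsRegular P ((fun s : Finset (Fin n → ℝ) => convexHull ℝ (s : Set (Fin n → ℝ))) '' K.facets) ∧
    IsFlag K.faces ∧
    ∀ s ∈ K.facets, IsUnimodularSimplex (affineSpan ℝ P).direction s

/-! ### Triangulations of cones -/

/-- A simplicial fan in `ℝⁿ`, each cone being recorded by the finite set of its chosen ray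
generators (the empty set records the cone `{0}`).  Generators of a cone are linearly independent,
faces of cones belong to the fan, and two cones meet in the cone over their common generators. -/
structure SimplicialFan (n : ℕ) where
  faces : Set (Finset (Fin n → ℝ))
  indep : ∀ s ∈ faces, LinearIndepOn ℝ id (s : Set (Fin n → ℝ))
  down_closed : ∀ s ∈ faces, ∀ t ⊆ s, t ∈ faces
  inter_subset : ∀ s ∈ faces, ∀ t ∈ faces,
    (PointedCone.hull ℝ (s : Set (Fin n → ℝ)) : Set (Fin n → ℝ)) ∩
        PointedCone.hull ℝ (t : Set (Fin n → ℝ)) ⊆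
      PointedCone.hull ℝ ((s : Set (Fin n → ℝ)) ∩ t)

namespace SimplicialFan

variable {n : ℕ}

/-- The cone generated by `s`, as a set. -/
def cone (s : Finset (Fin n → ℝ)) : Set (Fin n → ℝ) :=
  PointedCone.hull ℝ (s : Set (Fin n → ℝ))

/-- The union of all cones of the fan. -/
def support (T : SimplicialFan n) : Set (Fin n → ℝ) :=
  ⋃ s ∈ T.faces, cone s

/-- The generators of the rays of the fan. -/
def rayGenerators (T : SimplicialFan n) : Set (Fin n → ℝ) :=
  {v | {v} ∈ T.faces}

/-- The (generator sets of the) inclusion-maximal cones. -/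
def facets (T : SimplicialFan n) : Set (Finset (Fin n → ℝ)) :=
  {s | Maximal (fun s => s ∈ T.faces) s}

end SimplicialFan

/-- The finite simplicial fan `T` is a triangulation of the cone `C`. -/
def IsConeTriangulation {n : ℕ} (T : SimplicialFan n) (C : Set (Fin n → ℝ)) : Prop :=
  T.faces.Finite ∧ T.support = C

/-- The triangulation `T` of `C` is regular and flag, and each of its maximal cones is unimodular:
it is generated by a lattice basis of the integer points of the linear span of `C`. -/
def IsRegularFlagUnimodularConeTriangulation {n : ℕ}
    (T : SimplicialFan n) (C : Set (Fin n → ℝ)) : Prop :=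
  IsConeTriangulation T C ∧
    IsRegular C (SimplicialFan.cone '' T.facets) ∧
    IsFlag T.faces ∧
    ∀ s ∈ T.facets, IsLatticeBasis (latticeOf (Submodule.span ℝ C)) (s : Set (Fin n → ℝ))

/-! ### The simplex `R_n` and the lecture hall cone -/

/-- Column `j` (counted from `0`) of the matrix defining `R_n`: the entries above the diagonal are
`1`, those below are `0`, and the diagonal is `1, n - 1, n - 2, …, 1`. -/
def simplexVertex (n : ℕ) (j : Fin n) : Fin n → ℝ := fun i =>
  if i < j then 1
  else if i = j then (if (j : ℕ) = 0 then 1 else (n : ℝ) - (j : ℕ))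
  else 0

/-- The simplex `R_n`. -/
def R (n : ℕ) : Set (Fin n → ℝ) :=
  convexHull ℝ (Set.range (simplexVertex n))

/-- The lecture hall cone `L_n`: all `λ` with `0 ≤ λ₁/1 ≤ λ₂/2 ≤ ⋯ ≤ λₙ/n`; the coordinate
`λ_{i+1}` is `x i`. -/
def L (n : ℕ) : Set (Fin n → ℝ) :=
  {x | (∀ i, 0 ≤ x i / ((i : ℕ) + 1)) ∧ Monotone fun i : Fin n => x i / (((i : ℕ) : ℝ) + 1)}

/-- The vector `(0, …, 0, -1, 1)` (which is `(1)` for `n = 1`). -/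
def gradingVector (n : ℕ) : Fin n → ℝ := fun i =>
  if (i : ℕ) + 1 = n then 1 else if (i : ℕ) + 2 = n then -1 else 0

/-- The degree `λₙ - λₙ₋₁` of `λ` (with `λ₀ = 0`). -/
def degree {n : ℕ} (x : Fin n → ℝ) : ℝ :=
  ∑ i, gradingVector n i * x i

end LectureHall

/-! ### Cones, their degree-one slices, and certificates of regularity -/

namespace LectureHall

/-! Record a sequence by its gaps, last gap first: `x 0` is `λₙ - λₙ₋₁`, then `λₙ₋₁ - λₙ₋₂`, and so
on. This is a unimodular change of coordinates. The lecture hall inequalities then say that each gap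
is at least the average of the gaps after it, and that the final one is nonnegative; the degree
becomes `x 0`. In these coordinates `R n` is exactly the slice `x 0 = 1` of the cone (`R_eq_slice`).
Hence one triangulation of `gapCone`, unimodular and with all ray generators in degree one, serves
both claims: its slice triangulates `R n`, and its image under `tailSumsEquiv` triangulates `L n`.

The triangulation is built by induction on dimension (`IsGradedTriangulation.step`). The hyperplane
`x 0 = x 1` cuts the larger cone in two. Where `x 1 ≤ x 0` it is a pyramid with apex `e₀` over a
copy of the smaller cone, the first coordinate being doubled. Where `x 1 ≥ x 0` it is a chimney over
the same copy, with height `x 1 - x 0` between `0` and the linear function `excess`, which is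
integral at lattice points. Each simplex of the base is therefore replaced by its pyramid and by the
staircase simplices of the chimney over it, for one global ordering of the vertices. Adding an apex
or an edge of lattice length one keeps bases unimodular. Flagness follows because a staircase
simplex is determined by its base, its last raised vertex and the height there.

Regularity is carried by heights `w` on the generators together with, for each maximal cone, a
linear functional equal to `w` on that cone's generators and strictly below `w` on all others. The
upper envelope of these functionals is the required convex function (`isRegular_of_envelope`), and
the same functionals show that cones meet in common faces (`hull_inter_subset`). In the induction
step the heights are the old ones scaled by a large `M`, plus a convex quadratic on each vertical
segment, with a still larger height `γ` at the apex. -/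

open Finset in
theorem mem_hull_finset {E : Type*} [AddCommGroup E] [Module ℝ E] {s : Finset E} {x : E} :
    x ∈ PointedCone.hull ℝ (s : Set E) ↔
      ∃ c : E → ℝ, (∀ v ∈ s, 0 ≤ c v) ∧ ∑ v ∈ s, c v • v = x := by
  classical
  constructor
  · intro h
    obtain ⟨f, -, hf⟩ := Submodule.mem_span_finset.1 h
    exact ⟨fun v => f v, fun v _ => (f v).2, by simpa [Nonneg.mk_smul] using hf⟩
  · rintro ⟨c, hc, rfl⟩
    refine Submodule.sum_mem _ fun v hv => ?_
    exact Submodule.smul_mem _ (⟨c v, hc v hv⟩ : {r : ℝ // 0 ≤ r})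
      (Submodule.subset_span (by simpa using hv))

theorem mem_convexHull_iff_mem_hull {E : Type*} [AddCommGroup E] [Module ℝ E] {s : Finset E}
    {δ : E →ₗ[ℝ] ℝ} (hδ : ∀ v ∈ s, δ v = 1) {x : E} :
    x ∈ convexHull ℝ (s : Set E) ↔ x ∈ PointedCone.hull ℝ (s : Set E) ∧ δ x = 1 := by
  rw [Finset.mem_convexHull', mem_hull_finset]
  have key : ∀ c : E → ℝ, δ (∑ v ∈ s, c v • v) = ∑ v ∈ s, c v := fun c => by
    rw [map_sum]
    exact Finset.sum_congr rfl fun v hv => by simp [hδ v hv]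
  constructor
  · rintro ⟨c, hc, h1, rfl⟩
    exact ⟨⟨c, hc, rfl⟩, by rw [key, h1]⟩
  · rintro ⟨⟨c, hc, rfl⟩, h⟩
    exact ⟨c, hc, by rw [← key, h], rfl⟩

/-- A family of affine functionals whose upper envelope attains each functional exactly on a cell
that spans `P` affinely certifies that the cells form a regular subdivision of `P`. -/
theorem isRegular_of_envelope {E ι : Type*} [AddCommGroup E] [Module ℝ E] {P : Set E}
    (hP : Convex ℝ P) {S : Set ι} (hS : S.Finite) (hne : S.Nonempty) (G : ι → E →ᵃ[ℝ] ℝ)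
    (cell : ι → Set E)
    (hcell : ∀ i ∈ S, ∀ x, x ∈ cell i ↔ x ∈ P ∧ ∀ j ∈ S, G j x ≤ G i x)
    (hspan : ∀ i ∈ S, ∀ g : E →ᵃ[ℝ] ℝ, Set.EqOn g (G i) (cell i) → Set.EqOn g (G i) P) :
    IsRegular P (cell '' S) := by
  classical
  lift S to Finset ι using hS
  have hne' : S.Nonempty := by simpa using hne
  set f : E → ℝ := fun x => S.sup' hne' fun i => G i x with hf
  have hle : ∀ i ∈ S, ∀ x, G i x ≤ f x := fun i hi x => Finset.le_sup' (fun i => G i x) hi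
  have heq : ∀ i ∈ S, ∀ x ∈ cell i, f x = G i x := fun i hi x hx =>
    le_antisymm (Finset.sup'_le _ _ fun j hj => ((hcell i hi x).1 hx).2 j hj) (hle i hi x)
  have hmem : ∀ i ∈ S, ∀ x ∈ P, f x = G i x → x ∈ cell i := fun i hi x hx h =>
    (hcell i hi x).2 ⟨hx, fun j hj => (hle j hj x).trans h.le⟩
  have comb : ∀ (g : E →ᵃ[ℝ] ℝ) (x y : E) (a b : ℝ), a + b = 1 →
      g (a • x + b • y) = a * g x + b * g y := fun g x y a b h => by
    simpa using Convex.combo_affine_apply (f := g) h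
  have hconv : ∀ i ∈ S, Convex ℝ (cell i) := by
    intro i hi x hx y hy a b ha hb hab
    refine (hcell i hi _).2 ⟨hP ((hcell i hi x).1 hx).1 ((hcell i hi y).1 hy).1 ha hb hab, ?_⟩
    intro j hj
    rw [comb _ _ _ _ _ hab, comb _ _ _ _ _ hab]
    have := ((hcell i hi x).1 hx).2 j hj
    have := ((hcell i hi y).1 hy).2 j hj
    gcongr
  have hfc : ConvexOn ℝ P f := by
    refine ⟨hP, fun x _ y _ a b ha hb hab => Finset.sup'_le _ _ fun i hi => ?_⟩
    rw [comb _ _ _ _ _ hab, smul_eq_mul, smul_eq_mul]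
    have := hle i hi x
    have := hle i hi y
    gcongr
  have hsub : ∀ D : Set E, D ⊆ P → Convex ℝ D → (∃ g : E →ᵃ[ℝ] ℝ, Set.EqOn f g D) →
      ∃ i ∈ S, D ⊆ cell i := by
    rintro D hDP hD ⟨g, hg⟩
    by_contra! hcon
    have : ∀ i ∈ S, ∃ d ∈ D, G i d < g d := by
      intro i hi
      obtain ⟨d, hd, hdi⟩ := Set.not_subset.1 (hcon i hi)
      refine ⟨d, hd, ?_⟩
      rw [← hg hd]
      exact lt_of_le_of_ne (hle i hi d) fun h => hdi (hmem i hi d (hDP hd) h.symm)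
    -- On `D` every `G j` is at most `g`. Averaging one strict witness per index therefore produces
    -- a single point where all are strictly below `g`, although `f = g` there is attained by some
    -- `G i`.
    have main : ∀ T ⊆ S, T.Nonempty → ∃ d ∈ D, ∀ i ∈ T, G i d < g d := by
      intro T hTS hT
      induction hT using Finset.Nonempty.cons_induction with
      | singleton i =>
        obtain ⟨d, hd, h⟩ := this i (hTS (by simp))
        exact ⟨d, hd, by simpa using h⟩
      | cons i T hi hT ih =>
        obtain ⟨d, hd, h⟩ := ih fun j hj => hTS (by simp [hj])
        obtain ⟨e, he, h'⟩ := this i (hTS (by simp))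
        refine ⟨(1 / 2 : ℝ) • d + (1 / 2 : ℝ) • e,
          hD hd he (by norm_num) (by norm_num) (by norm_num), ?_⟩
        intro j hj
        rw [comb _ _ _ _ _ (by norm_num), comb _ _ _ _ _ (by norm_num)]
        have h1 : G j d ≤ g d := by rw [← hg hd]; exact hle j (hTS hj) d
        have h2 : G j e ≤ g e := by rw [← hg he]; exact hle j (hTS hj) e
        rcases Finset.mem_cons.1 hj with rfl | hj
        · linarith
        · linarith [h j hj]
    obtain ⟨d, hd, h⟩ := main S subset_rfl hne'
    obtain ⟨i, hi, hid⟩ := S.exists_mem_eq_sup' hne' fun i => G i d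
    have := h i hi
    rw [← hg hd] at this
    exact this.ne hid.symm
  refine ⟨f, hfc, Set.eq_of_subset_of_subset ?_ ?_⟩
  · rintro D ⟨⟨hDP, hD, hg⟩, hmax⟩
    obtain ⟨i, hi, hDi⟩ := hsub D hDP hD hg
    refine ⟨i, hi, Set.Subset.antisymm (hmax ⟨fun x hx => ((hcell i hi x).1 hx).1, hconv i hi,
      G i, fun x hx => heq i hi x hx⟩ hDi) hDi⟩
  · rintro _ ⟨i, hi, rfl⟩
    refine ⟨⟨fun x hx => ((hcell i hi x).1 hx).1, hconv i hi, G i, fun x hx => heq i hi x hx⟩, ?_⟩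
    rintro D ⟨hDP, -, g, hg⟩ hiD x hx
    refine hmem i hi x (hDP hx) ?_
    rw [hg hx]
    -- An affine function agreeing with `f` on a set containing the cell is forced to be `G i` on
    -- all of `P`, so that set cannot leave the cell.
    exact hspan i hi g (fun y hy => by rw [← hg (hiD hy), heq i hi y hy]) (hDP hx)

/-- If the lifted height of a conic combination is not above a functional supporting `w` along `s`,
then only generators in `s` occur. -/
theorem coeff_eq_zero_of_supporting {E : Type*} [AddCommGroup E] [Module ℝ E] {s t : Finset E}
    {w : E → ℝ} {g : E →ₗ[ℝ] ℝ}
    (hg : ∀ v ∈ t, v ∉ s → g v < w v) (hgs : ∀ v ∈ s, g v = w v) {c : E → ℝ} (hc : ∀ v ∈ t, 0 ≤ c v)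
    (hle : ∑ v ∈ t, c v * w v ≤ g (∑ v ∈ t, c v • v)) {v : E} (hv : v ∈ t) (hvs : v ∉ s) :
    c v = 0 := by
  by_contra hne
  have hpos : 0 < c v := lt_of_le_of_ne (hc v hv) (Ne.symm hne)
  refine absurd hle (not_le.2 ?_)
  rw [map_sum]
  simp only [map_smul, smul_eq_mul]
  refine Finset.sum_lt_sum (fun u hu => ?_) ⟨v, hv, by have := hg v hv hvs; gcongr⟩
  refine mul_le_mul_of_nonneg_left ?_ (hc u hu)
  by_cases hus : u ∈ s
  · exact (hgs u hus).le
  · exact (hg u hu hus).le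

/-- `𝓕` is the set of (generator sets of) maximal cones of a flag unimodular triangulation of the
cone `C` whose rays have degree one with respect to `δ`, and the heights `w` of the ray generators
certify its regularity. -/
structure IsGradedTriangulation {n : ℕ} (C : Set (Fin n → ℝ)) (δ : (Fin n → ℝ) →ₗ[ℝ] ℝ)
    (𝓕 : Set (Finset (Fin n → ℝ))) (w : (Fin n → ℝ) → ℝ) : Prop where
  finite : 𝓕.Finite
  card_eq : ∀ s ∈ 𝓕, s.card = n
  mem_lattice : ∀ s ∈ 𝓕, ∀ v ∈ s, v ∈ integerLattice n
  le_span : ∀ s ∈ 𝓕, integerLattice n ≤ Submodule.span ℤ (s : Set (Fin n → ℝ))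
  subset : ∀ s ∈ 𝓕, ∀ v ∈ s, v ∈ C
  degree_eq : ∀ s ∈ 𝓕, ∀ v ∈ s, δ v = 1
  cover : ∀ x ∈ C, ∃ s ∈ 𝓕, x ∈ PointedCone.hull ℝ (s : Set (Fin n → ℝ))
  supporting : ∀ s ∈ 𝓕, ∃ g : (Fin n → ℝ) →ₗ[ℝ] ℝ, (∀ v ∈ s, g v = w v) ∧
    ∀ t ∈ 𝓕, ∀ v ∈ t, v ∉ s → g v < w v
  flag : ∀ t : Finset (Fin n → ℝ), (∀ a ∈ t, ∀ b ∈ t, ∃ s ∈ 𝓕, a ∈ s ∧ b ∈ s) → ∃ s ∈ 𝓕, t ⊆ s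

theorem single_mem_integerLattice {n : ℕ} (i : Fin n) :
    (Pi.single i 1 : Fin n → ℝ) ∈ integerLattice n := by
  intro j
  by_cases h : j = i
  · subst h; exact ⟨1, by simp⟩
  · exact ⟨0, by simp [h]⟩

theorem top_le_span_of_integerLattice_le {n : ℕ} {s : Set (Fin n → ℝ)}
    (h : integerLattice n ≤ Submodule.span ℤ s) : ⊤ ≤ Submodule.span ℝ s := by
  rw [← (Pi.basisFun ℝ (Fin n)).span_eq, Submodule.span_le]
  rintro _ ⟨i, rfl⟩
  exact Submodule.span_le_restrictScalars ℤ ℝ s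
    (h (by simpa using single_mem_integerLattice i))

/-! ### Bases, supporting functionals and intersections of cones -/

namespace IsGradedTriangulation

variable {n : ℕ} {C : Set (Fin n → ℝ)} {δ : (Fin n → ℝ) →ₗ[ℝ] ℝ}
  {𝓕 : Set (Finset (Fin n → ℝ))} {w : (Fin n → ℝ) → ℝ}

theorem linearIndepOn (h : IsGradedTriangulation C δ 𝓕 w) {s : Finset (Fin n → ℝ)} (hs : s ∈ 𝓕) :
    LinearIndepOn ℝ id (s : Set (Fin n → ℝ)) := by
  refine linearIndependent_of_top_le_span_of_card_eq_finrank
    (b := fun v : (s : Set (Fin n → ℝ)) => id (v : Fin n → ℝ)) ?_ (by simp [h.card_eq s hs])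
  simpa using top_le_span_of_integerLattice_le (h.le_span s hs)

theorem span_eq (h : IsGradedTriangulation C δ 𝓕 w) {s : Finset (Fin n → ℝ)} (hs : s ∈ 𝓕) :
    Submodule.span ℤ (s : Set (Fin n → ℝ)) = integerLattice n :=
  le_antisymm (Submodule.span_le.2 fun v hv => h.mem_lattice s hs v hv) (h.le_span s hs)

theorem exists_functional (h : IsGradedTriangulation C δ 𝓕 w) {s : Finset (Fin n → ℝ)}
    (hs : s ∈ 𝓕) (φ : (Fin n → ℝ) → ℝ) :
    ∃ g : (Fin n → ℝ) →ₗ[ℝ] ℝ, ∀ v ∈ s, g v = φ v := by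
  let b := Module.Basis.mk (h.linearIndepOn hs)
    (by simpa using top_le_span_of_integerLattice_le (h.le_span s hs))
  refine ⟨b.constr ℝ fun v => φ v, fun v hv => ?_⟩
  have := b.constr_basis ℝ (fun v => φ v) ⟨v, hv⟩
  simpa [b] using this

theorem eq_of_subset (h : IsGradedTriangulation C δ 𝓕 w) {s t : Finset (Fin n → ℝ)}
    (hs : s ∈ 𝓕) (ht : t ∈ 𝓕) (hst : s ⊆ t) : s = t :=
  Finset.eq_of_subset_of_card_le hst (by rw [h.card_eq s hs, h.card_eq t ht])

/-- On its own cone `g s` computes the height of the conic combination, while every other `g t` can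
only underestimate it. Conversely, expand `x` in a cone `t` covering it: if `g s x` reaches the
height `g t x`, generators outside `s` have coefficient zero. -/
theorem mem_hull_iff (h : IsGradedTriangulation C δ 𝓕 w)
    {g : Finset (Fin n → ℝ) → (Fin n → ℝ) →ₗ[ℝ] ℝ} (hgs : ∀ s ∈ 𝓕, ∀ v ∈ s, g s v = w v)
    (hg : ∀ s ∈ 𝓕, ∀ t ∈ 𝓕, ∀ v ∈ t, v ∉ s → g s v < w v) {s : Finset (Fin n → ℝ)} (hs : s ∈ 𝓕)
    {x : Fin n → ℝ} (hx : x ∈ C) :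
    x ∈ PointedCone.hull ℝ (s : Set (Fin n → ℝ)) ↔ ∀ t ∈ 𝓕, g t x ≤ g s x := by
  constructor
  · intro hxs t ht
    obtain ⟨c, hc, rfl⟩ := mem_hull_finset.1 hxs
    simp only [map_sum, map_smul, smul_eq_mul]
    refine Finset.sum_le_sum fun v hv => mul_le_mul_of_nonneg_left ?_ (hc v hv)
    rw [hgs s hs v hv]
    by_cases hvt : v ∈ t
    · exact (hgs t ht v hvt).le
    · exact (hg t ht s hs v hv hvt).le
  · intro hle
    obtain ⟨t, ht, hxt⟩ := h.cover x hx
    obtain ⟨c, hc, rfl⟩ := mem_hull_finset.1 hxt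
    refine Submodule.sum_mem _ fun v hv => ?_
    by_cases hvs : v ∈ s
    · exact Submodule.smul_mem _ (⟨c v, hc v hv⟩ : {r : ℝ // 0 ≤ r}) (Submodule.subset_span hvs)
    · rw [coeff_eq_zero_of_supporting (hg s hs t ht) (hgs s hs) hc ?_ hv hvs, zero_smul]
      · exact Submodule.zero_mem _
      refine le_trans (le_of_eq ?_) (hle t ht)
      simp only [map_sum, map_smul, smul_eq_mul]
      exact Finset.sum_congr rfl fun u hu => by rw [hgs t ht u hu]

/-- Expand a common point in `s` and in `t`. The supporting functionals kill the coefficients of the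
second expansion outside `s₀`, so both are expansions in the independent set `s₀` and coincide; only
generators in `s ∩ t` survive. -/
theorem hull_inter_subset (h : IsGradedTriangulation C δ 𝓕 w) {s₀ t₀ s t : Finset (Fin n → ℝ)}
    (hs₀ : s₀ ∈ 𝓕) (ht₀ : t₀ ∈ 𝓕) (hs : s ⊆ s₀) (ht : t ⊆ t₀) :
    (PointedCone.hull ℝ (s : Set (Fin n → ℝ)) : Set (Fin n → ℝ)) ∩
        PointedCone.hull ℝ (t : Set (Fin n → ℝ)) ⊆
      PointedCone.hull ℝ ((s : Set (Fin n → ℝ)) ∩ t) := by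
  classical
  rintro x ⟨hxs, hxt⟩
  obtain ⟨c, hc, hcx⟩ := mem_hull_finset.1 hxs
  obtain ⟨d, hd, hdx⟩ := mem_hull_finset.1 hxt
  obtain ⟨g, hgs, hg⟩ := h.supporting s₀ hs₀
  obtain ⟨g', hgs', hg'⟩ := h.supporting t₀ ht₀
  have ext : ∀ {a b : Finset (Fin n → ℝ)} (e : (Fin n → ℝ) → ℝ), a ⊆ b →
      ∑ v ∈ b, (if v ∈ a then e v else 0) • v = ∑ v ∈ a, e v • v := fun {a b} e hab => by
    rw [← Finset.sum_subset hab (fun v _ hv => by simp [hv])]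
    exact Finset.sum_congr rfl fun v hv => by simp [hv]
  -- The left side is the height of `x` measured in `t₀`, that is `g' x`. Since `x` is also a conic
  -- combination of generators in `s₀`, where `g` equals `w` and `g'` is at most `w`, it is bounded
  -- by `g x`.
  have hle : ∑ v ∈ t₀, (if v ∈ t then d v else 0) * w v ≤
      g (∑ v ∈ t₀, (if v ∈ t then d v else 0) • v) := by
    have h1 : ∑ v ∈ t₀, (if v ∈ t then d v else 0) * w v = g' x := by
      rw [← hdx, ← ext d ht, map_sum]
      refine Finset.sum_congr rfl fun v hv => ?_
      rw [map_smul, hgs' v hv, smul_eq_mul]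
    have h2 : g' x ≤ g x := by
      rw [← hcx]
      simp only [map_sum, map_smul, smul_eq_mul]
      refine Finset.sum_le_sum fun v hv => mul_le_mul_of_nonneg_left ?_ (hc v hv)
      rw [hgs v (hs hv)]
      by_cases hvt : v ∈ t₀
      · exact (hgs' v hvt).le
      · exact (hg' s₀ hs₀ v (hs hv) hvt).le
    rw [h1, ext d ht, hdx]
    exact h2
  have hzero : ∀ v ∈ t, v ∉ s₀ → d v = 0 := fun v hv hvs => by
    simpa [hv] using coeff_eq_zero_of_supporting (hg t₀ ht₀) hgs
      (fun u _ => by split_ifs with hu; exacts [hd u hu, le_rfl]) hle (ht hv) hvs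
  have hd' : ∑ v ∈ s₀, (if v ∈ t then d v else 0) • v = x := by
    rw [← hdx]
    calc _ = ∑ v ∈ s₀ ∩ t, d v • v := by
          rw [← ext d (Finset.inter_subset_left : s₀ ∩ t ⊆ s₀)]
          exact Finset.sum_congr rfl fun v hv => by simp [hv]
      _ = _ := Finset.sum_subset Finset.inter_subset_right fun v hv hv' => by
          rw [hzero v hv fun h => hv' (by simp [h, hv]), zero_smul]
  have hdiff := linearIndepOn_finset_iff.1 (h.linearIndepOn hs₀)
    (fun v => (if v ∈ s then c v else 0) - if v ∈ t then d v else 0) (by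
      simp only [sub_smul, Finset.sum_sub_distrib, id]
      rw [ext c hs, hcx, hd', sub_self])
  rw [← Finset.coe_inter]
  refine mem_hull_finset.2 ⟨c, fun v hv => hc v (Finset.mem_inter.1 hv).1, ?_⟩
  rw [← hcx]
  refine Finset.sum_subset Finset.inter_subset_left fun v hv hv' => ?_
  have := hdiff v (hs hv)
  have hvt : v ∉ t := fun h => hv' (Finset.mem_inter.2 ⟨hv, h⟩)
  simp only [hv, hvt, if_true, if_false, sub_zero] at this
  rw [this, zero_smul]

end IsGradedTriangulation

/-! ### The fan and the simplicial complex of its degree-one slice -/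

namespace IsGradedTriangulation

variable {n : ℕ} {δ : (Fin n → ℝ) →ₗ[ℝ] ℝ}
  {𝓕 : Set (Finset (Fin n → ℝ))} {w : (Fin n → ℝ) → ℝ}

section Faces

variable {C : Set (Fin n → ℝ)}

theorem finite_faces (h : IsGradedTriangulation C δ 𝓕 w) :
    {t : Finset (Fin n → ℝ) | ∃ s ∈ 𝓕, t ⊆ s}.Finite := by
  refine (h.finite.biUnion fun s _ => (s.powerset.finite_toSet)).subset ?_
  rintro t ⟨s, hs, hts⟩
  exact Set.mem_biUnion hs (by simpa using hts)

/-- The `flag` field says that cliques are faces. In a minimal non-face with more than two vertices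
every pair is a proper subset, hence a face, so the whole set would be a face. -/
theorem card_eq_two (h : IsGradedTriangulation C δ 𝓕 w) {t : Finset (Fin n → ℝ)}
    (hne : t.Nonempty) (ht : ¬ ∃ s ∈ 𝓕, t ⊆ s) (hv : ∀ v ∈ t, ∃ s ∈ 𝓕, v ∈ s)
    (hsub : ∀ u ⊂ t, u.Nonempty → ∃ s ∈ 𝓕, u ⊆ s) : t.card = 2 := by
  classical
  by_contra hcard
  have h1 : t.card ≠ 1 := fun h1 => by
    obtain ⟨v, rfl⟩ := Finset.card_eq_one.1 h1
    exact ht (by simpa using hv v (by simp))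
  have h2 : 2 < t.card := by have := hne.card_pos; omega
  refine ht (h.flag t fun a ha b hb => ?_)
  obtain ⟨s, hs, hss⟩ := hsub {a, b} (by
    refine (Finset.ssubset_iff_subset_ne).2 ⟨by simp [Finset.insert_subset_iff, ha, hb], ?_⟩
    rintro rfl
    exact absurd Finset.card_le_two (not_le.2 h2)) (by simp)
  exact ⟨s, hs, hss (by simp), hss (by simp)⟩

theorem mem_span (h : IsGradedTriangulation C δ 𝓕 w) {s : Finset (Fin n → ℝ)} (hs : s ∈ 𝓕)
    (x : Fin n → ℝ) : ∃ c : (Fin n → ℝ) → ℝ, ∑ v ∈ s, c v • v = x := by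
  obtain ⟨f, -, hf⟩ := Submodule.mem_span_finset.1
    (top_le_span_of_integerLattice_le (h.le_span s hs) (Submodule.mem_top (x := x)))
  exact ⟨f, hf⟩

theorem degree_sum (h : IsGradedTriangulation C δ 𝓕 w) {s : Finset (Fin n → ℝ)} (hs : s ∈ 𝓕)
    (c : (Fin n → ℝ) → ℝ) : δ (∑ v ∈ s, c v • v) = ∑ v ∈ s, c v := by
  rw [map_sum]
  exact Finset.sum_congr rfl fun v hv => by simp [h.degree_eq s hs v hv]

/-- All generators have degree one, so the coefficients of a point of degree one sum to `1`: it is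
an affine combination of the generators in `s`. -/
theorem eqOn_of_eqOn (h : IsGradedTriangulation C δ 𝓕 w) {s : Finset (Fin n → ℝ)} (hs : s ∈ 𝓕)
    {g g' : (Fin n → ℝ) →ᵃ[ℝ] ℝ} (hg : ∀ v ∈ s, g v = g' v) {x : Fin n → ℝ} (hx : δ x = 1) :
    g x = g' x := by
  obtain ⟨c, rfl⟩ := h.mem_span hs x
  rw [h.degree_sum hs] at hx
  have key : ∀ g : (Fin n → ℝ) →ᵃ[ℝ] ℝ, g (∑ v ∈ s, c v • v) = ∑ v ∈ s, c v * g v := fun g => by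
    have hd : ∀ y, g y = g.linear y + g 0 := fun y => congrFun g.decomp y
    rw [hd, map_sum]
    conv_rhs => enter [2, v]; rw [hd, mul_add]
    rw [Finset.sum_add_distrib, ← Finset.sum_mul, hx, one_mul]
    simp
  rw [key, key]
  exact Finset.sum_congr rfl fun v hv => by rw [hg v hv]

end Faces

variable {C : PointedCone ℝ (Fin n → ℝ)}

theorem hull_subset (h : IsGradedTriangulation (C : Set (Fin n → ℝ)) δ 𝓕 w)
    {s t : Finset (Fin n → ℝ)} (hs : s ∈ 𝓕) (ht : t ⊆ s) :
    (PointedCone.hull ℝ (t : Set (Fin n → ℝ)) : Set (Fin n → ℝ)) ⊆ C :=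
  Submodule.span_le.2 fun v hv => h.subset s hs v (ht hv)

theorem nonempty (h : IsGradedTriangulation (C : Set (Fin n → ℝ)) δ 𝓕 w) : 𝓕.Nonempty :=
  let ⟨s, hs, _⟩ := h.cover 0 C.zero_mem
  ⟨s, hs⟩

/-- The simplicial fan with given maximal cones. -/
def fan (h : IsGradedTriangulation (C : Set (Fin n → ℝ)) δ 𝓕 w) : SimplicialFan n where
  faces := {t | ∃ s ∈ 𝓕, t ⊆ s}
  indep := fun _ ⟨_, hs, hts⟩ => (h.linearIndepOn hs).mono (by exact_mod_cast hts)
  down_closed := fun _ ⟨s, hs, hts⟩ _ hut => ⟨s, hs, hut.trans hts⟩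
  inter_subset := fun _ ⟨_, hs, hts⟩ _ ⟨_, hs', hts'⟩ => h.hull_inter_subset hs hs' hts hts'

theorem facets_fan (h : IsGradedTriangulation (C : Set (Fin n → ℝ)) δ 𝓕 w) :
    h.fan.facets = 𝓕 := by
  ext s
  constructor
  · rintro ⟨⟨t, ht, hst⟩, hmax⟩
    rwa [hst.antisymm (hmax ⟨t, ht, subset_rfl⟩ hst)]
  · refine fun hs => ⟨⟨s, hs, subset_rfl⟩, ?_⟩
    rintro t ⟨u, hu, htu⟩ hst
    exact htu.trans (h.eq_of_subset hs hu (hst.trans htu)).ge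

theorem convex (C : PointedCone ℝ (Fin n → ℝ)) : Convex ℝ (C : Set (Fin n → ℝ)) :=
  (C : ConvexCone ℝ (Fin n → ℝ)).convex

theorem fan_isTriangulation (h : IsGradedTriangulation (C : Set (Fin n → ℝ)) δ 𝓕 w) :
    IsRegularFlagUnimodularConeTriangulation h.fan C := by
  refine ⟨⟨h.finite_faces, ?_⟩, ?_, ?_, ?_⟩
  · refine Set.Subset.antisymm ?_ fun x hx => ?_
    · refine Set.iUnion₂_subset ?_
      rintro t ⟨s, hs, hts⟩
      exact h.hull_subset hs hts
    · obtain ⟨s, hs, hxs⟩ := h.cover x hx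
      exact Set.mem_biUnion (show s ∈ h.fan.faces from ⟨s, hs, subset_rfl⟩) hxs
  · rw [h.facets_fan]
    have hsupp := h.supporting
    choose! g hgs hg using hsupp
    refine isRegular_of_envelope (convex C) h.finite h.nonempty (fun s => (g s).toAffineMap) _
      ?_ ?_
    · intro s hs x
      constructor
      · exact fun hx => ⟨h.hull_subset hs subset_rfl hx,
          (h.mem_hull_iff hgs hg hs (h.hull_subset hs subset_rfl hx)).1 hx⟩
      · exact fun hx => (h.mem_hull_iff hgs hg hs hx.1).2 hx.2
    · intro s hs f hf x _
      have hmem : ∀ v ∈ s, v ∈ SimplicialFan.cone s := fun v hv => Submodule.subset_span hv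
      -- Every cone contains the origin, so an affine function that agrees there with a linear one
      -- is itself linear.
      have h0 : f 0 = 0 := by
        rw [hf (show (0 : Fin n → ℝ) ∈ SimplicialFan.cone s from Submodule.zero_mem _)]
        simp
      have hd : ∀ y, f y = f.linear y := fun y => by
        have := congrFun f.decomp y
        simpa [h0] using this
      obtain ⟨c, rfl⟩ := h.mem_span hs x
      rw [hd, LinearMap.coe_toAffineMap, map_sum, map_sum]
      refine Finset.sum_congr rfl fun v hv => ?_
      rw [map_smul, map_smul, ← hd, hf (hmem v hv), LinearMap.coe_toAffineMap]
  · rintro t ⟨hne, hv, ht, hsub⟩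
    refine h.card_eq_two hne ht (fun v hvt => ?_) hsub
    simpa [fan] using hv v hvt
  · rw [h.facets_fan]
    intro s hs
    have htop : Submodule.span ℝ (C : Set (Fin n → ℝ)) = ⊤ :=
      top_le_iff.1 ((top_le_span_of_integerLattice_le (h.le_span s hs)).trans
        (Submodule.span_mono fun v hv => h.subset s hs v hv))
    refine ⟨(h.linearIndepOn hs).restrict_scalars fun a b hab => by simpa using hab, ?_⟩
    rw [h.span_eq hs, htop]
    ext x
    simp [latticeOf]

theorem degree_of_mem_rayGenerators (h : IsGradedTriangulation (C : Set (Fin n → ℝ)) δ 𝓕 w)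
    {v : Fin n → ℝ} (hv : v ∈ h.fan.rayGenerators) : δ v = 1 := by
  obtain ⟨s, hs, hvs⟩ := hv
  exact h.degree_eq s hs v (by simpa using hvs)

/-- The slice of the fan in degree one. -/
def complex (h : IsGradedTriangulation (C : Set (Fin n → ℝ)) δ 𝓕 w) :
    Geometry.SimplicialComplex ℝ (Fin n → ℝ) where
  faces := {t | t.Nonempty ∧ ∃ s ∈ 𝓕, t ⊆ s}
  isRelLowerSet_faces := fun _ ⟨hne, s, hs, hts⟩ =>
    ⟨hne, fun _ hut hune => ⟨hune, s, hs, hut.trans hts⟩⟩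
  indep := fun ⟨_, _, hs, hts⟩ => LinearIndependent.affineIndependent ℝ
    ((h.linearIndepOn hs).mono (by exact_mod_cast hts))
  inter_subset_convexHull := by
    classical
    rintro s t ⟨-, s₀, hs₀, hs⟩ ⟨-, t₀, ht₀, ht⟩ x ⟨hxs, hxt⟩
    have hxs := (mem_convexHull_iff_mem_hull fun v hv => h.degree_eq s₀ hs₀ v (hs hv)).1 hxs
    have hxt := (mem_convexHull_iff_mem_hull fun v hv => h.degree_eq t₀ ht₀ v (ht hv)).1 hxt
    have := h.hull_inter_subset hs₀ ht₀ hs ht ⟨hxs.1, hxt.1⟩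
    rw [← Finset.coe_inter] at this ⊢
    exact (mem_convexHull_iff_mem_hull fun v hv =>
      h.degree_eq s₀ hs₀ v (hs (Finset.mem_inter.1 hv).1)).2 ⟨this, hxs.2⟩

theorem nonempty_of_mem [NeZero n] {C : Set (Fin n → ℝ)} (h : IsGradedTriangulation C δ 𝓕 w)
    {s : Finset (Fin n → ℝ)} (hs : s ∈ 𝓕) : s.Nonempty :=
  Finset.card_pos.1 (by rw [h.card_eq s hs]; exact Nat.pos_of_neZero n)

theorem facets_complex [NeZero n] (h : IsGradedTriangulation (C : Set (Fin n → ℝ)) δ 𝓕 w) :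
    h.complex.facets = 𝓕 := by
  ext s
  constructor
  · rintro ⟨⟨hne, t, ht, hst⟩, hmax⟩
    rwa [hmax ⟨hne.mono hst, t, ht, subset_rfl⟩ hst]
  · refine fun hs => ⟨⟨h.nonempty_of_mem hs, s, hs, subset_rfl⟩, ?_⟩
    rintro t ⟨-, u, hu, htu⟩ hst
    exact hst.antisymm (htu.trans (h.eq_of_subset hs hu (hst.trans htu)).ge)

theorem direction_affineSpan_slice [NeZero n]
    (h : IsGradedTriangulation (C : Set (Fin n → ℝ)) δ 𝓕 w) :
    (affineSpan ℝ {x | x ∈ C ∧ δ x = 1}).direction = LinearMap.ker δ := by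
  obtain ⟨s, hs⟩ := h.nonempty
  obtain ⟨v₀, hv₀⟩ := h.nonempty_of_mem hs
  rw [_root_.direction_affineSpan]
  apply le_antisymm
  · refine Submodule.span_le.2 ?_
    rintro _ ⟨x, hx, y, hy, rfl⟩
    simp [hx.2, hy.2]
  · intro x hx
    obtain ⟨c, rfl⟩ := h.mem_span hs x
    rw [LinearMap.mem_ker, h.degree_sum hs] at hx
    have : ∑ v ∈ s, c v • v = ∑ v ∈ s, c v • (v - v₀) := by
      simp [smul_sub, ← Finset.sum_smul, hx]
    rw [this]
    exact Submodule.sum_mem _ fun v hv => Submodule.smul_mem _ _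
      (vsub_mem_vectorSpan ℝ ⟨h.subset s hs v hv, h.degree_eq s hs v hv⟩
        ⟨h.subset s hs v₀ hv₀, h.degree_eq s hs v₀ hv₀⟩)

/-- A lattice vector of degree zero has integer coefficients with sum zero in the basis `s`, so it
is the same integer combination of the differences `v - v₀`. -/
theorem isUnimodularSimplex [NeZero n] {C : Set (Fin n → ℝ)} (h : IsGradedTriangulation C δ 𝓕 w)
    {s : Finset (Fin n → ℝ)} (hs : s ∈ 𝓕) : IsUnimodularSimplex (LinearMap.ker δ) s := by
  classical
  obtain ⟨v₀, hv₀⟩ := h.nonempty_of_mem hs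
  refine ⟨h.mem_lattice s hs, v₀, hv₀, ?_, le_antisymm (Submodule.span_le.2 ?_) ?_⟩
  · refine LinearIndepOn.id_image ?_
    have : AffineIndependent ℝ (Subtype.val : ↥(s : Set (Fin n → ℝ)) → Fin n → ℝ) :=
      LinearIndependent.affineIndependent ℝ (h.linearIndepOn hs)
    rw [affineIndependent_set_iff_linearIndependent_vsub ℝ (p₁ := v₀) hv₀] at this
    have h2 : LinearIndepOn ℝ id ((fun v => v - v₀) '' ((s : Set (Fin n → ℝ)) \ {v₀})) := this
    have h3 := (linearIndepOn_iff_image (f := fun v => v - v₀) sub_left_injective.injOn).2 h2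
    exact h3.restrict_scalars fun a b hab => by simpa using hab
  · rintro _ ⟨v, ⟨hv, -⟩, rfl⟩
    refine ⟨Submodule.sub_mem _ (h.mem_lattice s hs v hv) (h.mem_lattice s hs v₀ hv₀), ?_⟩
    simp [h.degree_eq s hs v hv, h.degree_eq s hs v₀ hv₀]
  · rintro x ⟨hx, hx'⟩
    obtain ⟨c, -, rfl⟩ := Submodule.mem_span_finset.1 (h.le_span s hs hx)
    have hsum : ∑ v ∈ s, c v = 0 := by
      have hx' : δ (∑ v ∈ s, c v • v) = 0 := hx'
      have e : ∑ v ∈ s, c v • v = ∑ v ∈ s, (fun v => (c v : ℝ)) v • v :=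
        Finset.sum_congr rfl fun v _ => (Int.cast_smul_eq_zsmul ℝ _ _).symm
      rw [e, h.degree_sum hs] at hx'
      exact_mod_cast hx'
    have : ∑ v ∈ s, c v • v = ∑ v ∈ s, c v • (v - v₀) := by
      simp only [smul_sub, Finset.sum_sub_distrib, ← Finset.sum_smul, hsum, zero_smul, sub_zero]
    rw [this]
    refine Submodule.sum_mem _ fun v hv => Submodule.smul_mem _ _ ?_
    by_cases hvv : v = v₀
    · simp [hvv]
    · exact Submodule.subset_span ⟨v, ⟨hv, hvv⟩, rfl⟩

theorem hasTriangulation [NeZero n] (h : IsGradedTriangulation (C : Set (Fin n → ℝ)) δ 𝓕 w) :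
    HasRegularFlagUnimodularTriangulation {x | x ∈ C ∧ δ x = 1} := by
  have hP : Convex ℝ {x | x ∈ C ∧ δ x = 1} := by
    intro x hx y hy a b ha hb hab
    refine ⟨convex C hx.1 hy.1 ha hb hab, ?_⟩
    simp [hx.2, hy.2, hab]
  have hmem : ∀ s ∈ 𝓕, ∀ t ⊆ s, ∀ x, x ∈ convexHull ℝ (t : Set (Fin n → ℝ)) ↔
      x ∈ PointedCone.hull ℝ (t : Set (Fin n → ℝ)) ∧ δ x = 1 := fun s hs t ht x =>
    mem_convexHull_iff_mem_hull fun v hv => h.degree_eq s hs v (ht hv)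
  refine ⟨h.complex, ⟨h.finite_faces.subset fun t ht => ht.2, ?_⟩, ?_, ?_, ?_⟩
  · refine Set.Subset.antisymm ?_ fun x hx => ?_
    · refine Set.iUnion₂_subset ?_
      rintro t ⟨-, s, hs, hts⟩ x hx
      rw [hmem s hs t hts] at hx
      exact ⟨h.hull_subset hs hts hx.1, hx.2⟩
    · obtain ⟨s, hs, hxs⟩ := h.cover x hx.1
      exact Set.mem_biUnion (show s ∈ h.complex.faces from
        ⟨h.nonempty_of_mem hs, s, hs, subset_rfl⟩) ((hmem s hs s subset_rfl x).2 ⟨hxs, hx.2⟩)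
  · rw [h.facets_complex]
    have hsupp := h.supporting
    choose! g hgs hg using hsupp
    refine isRegular_of_envelope hP h.finite h.nonempty (fun s => (g s).toAffineMap) _ ?_ ?_
    · intro s hs x
      rw [hmem s hs s subset_rfl]
      constructor
      · exact fun hx => ⟨⟨h.hull_subset hs subset_rfl hx.1, hx.2⟩,
          (h.mem_hull_iff hgs hg hs (h.hull_subset hs subset_rfl hx.1)).1 hx.1⟩
      · exact fun hx => ⟨(h.mem_hull_iff hgs hg hs hx.1.1).2 hx.2, hx.1.2⟩
    · intro s hs f hf x hx
      exact h.eqOn_of_eqOn hs (fun v hv => hf (subset_convexHull ℝ _ hv)) hx.2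
  · rintro t ⟨hne, hv, ht, hsub⟩
    refine h.card_eq_two hne (fun hs => ht ⟨hne, hs⟩) (fun v hvt => ?_)
      fun u hu hune => (hsub u hu hune).2
    simpa using (hv v hvt).2
  · rw [h.facets_complex, h.direction_affineSpan_slice]
    exact fun s hs => h.isUnimodularSimplex hs

end IsGradedTriangulation
/-! ### The lecture hall cone in gap coordinates -/

/-- The linear functional `m x₀ - (x₁ + ⋯ + xₘ)`. -/
def excess (m : ℕ) : (Fin (m + 1) → ℝ) →ₗ[ℝ] ℝ :=
  (m : ℝ) • LinearMap.proj 0 - ∑ i : Fin m, LinearMap.proj i.succ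

theorem excess_apply (m : ℕ) (x : Fin (m + 1) → ℝ) :
    excess m x = m * x 0 - ∑ i : Fin m, x i.succ := by
  simp [excess]

/-- The linear map deleting the first coordinate. -/
def tailMap (m : ℕ) : (Fin (m + 1) → ℝ) →ₗ[ℝ] (Fin m → ℝ) :=
  LinearMap.funLeft ℝ ℝ Fin.succ

/-- The cone of all vectors with `x₀` at least the average of the later coordinates, `x₁` at least
the average of the coordinates after it, and so on, and with nonnegative last coordinate. -/
noncomputable def gapCone : (m : ℕ) → PointedCone ℝ (Fin (m + 1) → ℝ)
  | 0 => (PointedCone.positive ℝ ℝ).comap (LinearMap.proj 0)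
  | m + 1 => (gapCone m).comap (tailMap (m + 1)) ⊓
      (PointedCone.positive ℝ ℝ).comap (excess (m + 1))

theorem mem_gapCone_zero {x : Fin 1 → ℝ} : x ∈ gapCone 0 ↔ 0 ≤ x 0 := by
  simp [gapCone]

theorem mem_gapCone_succ {m : ℕ} {x : Fin (m + 2) → ℝ} :
    x ∈ gapCone (m + 1) ↔ tailMap (m + 1) x ∈ gapCone m ∧ 0 ≤ excess (m + 1) x := by
  simp [gapCone]

theorem excess_nonneg {m : ℕ} {x : Fin (m + 1) → ℝ} (hx : x ∈ gapCone m) : 0 ≤ excess m x := by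
  cases m with
  | zero => simp [excess_apply]
  | succ m => exact (mem_gapCone_succ.1 hx).2

theorem single_zero_mem_gapCone (m : ℕ) : (Pi.single 0 1 : Fin (m + 1) → ℝ) ∈ gapCone m := by
  cases m with
  | zero => simp [mem_gapCone_zero]
  | succ m =>
    refine mem_gapCone_succ.2 ⟨?_, ?_⟩
    · convert (gapCone m).zero_mem
      ext i
      simp [tailMap, LinearMap.funLeft_apply]
    · simp [excess_apply]
      positivity

/-- Repeat the first coordinate. -/
def dupMap (m : ℕ) : (Fin (m + 1) → ℝ) →ₗ[ℝ] (Fin (m + 2) → ℝ) :=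
  LinearMap.funLeft ℝ ℝ (Fin.cases 0 id)

/-- Delete the second coordinate. -/
def skipMap (m : ℕ) : (Fin (m + 2) → ℝ) →ₗ[ℝ] (Fin (m + 1) → ℝ) :=
  LinearMap.funLeft ℝ ℝ (Fin.cases 0 fun i => i.succ.succ)

section Maps

variable {m : ℕ}

@[simp] theorem dupMap_zero (v : Fin (m + 1) → ℝ) : dupMap m v 0 = v 0 := rfl

@[simp] theorem dupMap_succ (v : Fin (m + 1) → ℝ) (i : Fin (m + 1)) :
    dupMap m v i.succ = v i := rfl

@[simp] theorem dupMap_one (v : Fin (m + 1) → ℝ) : dupMap m v 1 = v 0 := rfl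

@[simp] theorem tailMap_apply (x : Fin (m + 1) → ℝ) (i : Fin m) : tailMap m x i = x i.succ := rfl

@[simp] theorem skipMap_zero (x : Fin (m + 2) → ℝ) : skipMap m x 0 = x 0 := rfl

@[simp] theorem skipMap_succ (x : Fin (m + 2) → ℝ) (i : Fin m) :
    skipMap m x i.succ = x i.succ.succ := rfl

@[simp] theorem tailMap_dupMap (v : Fin (m + 1) → ℝ) : tailMap (m + 1) (dupMap m v) = v := rfl

@[simp] theorem skipMap_dupMap (v : Fin (m + 1) → ℝ) : skipMap m (dupMap m v) = v := by
  ext i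
  cases i using Fin.cases <;> simp

@[simp] theorem tailMap_single_zero : tailMap m (Pi.single 0 1) = 0 := by
  ext i
  simp

@[simp] theorem tailMap_single_one :
    tailMap (m + 1) (Pi.single 1 1) = Pi.single 0 1 := by
  ext i
  cases i using Fin.cases with
  | zero => simp
  | succ i => simp [Fin.ext_iff]

@[simp] theorem skipMap_single_one : skipMap m (Pi.single 1 1) = 0 := by
  ext i
  cases i using Fin.cases with
  | zero => simp
  | succ i => simp [Fin.ext_iff]

@[simp] theorem skipMap_single_zero : skipMap m (Pi.single 0 1) = Pi.single 0 1 := by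
  ext i
  cases i using Fin.cases with
  | zero => simp
  | succ i => simp

theorem eq_dupMap_tailMap (x : Fin (m + 2) → ℝ) :
    x = dupMap m (tailMap (m + 1) x) + (x 0 - x 1) • Pi.single 0 1 := by
  ext i
  cases i using Fin.cases with
  | zero => simp
  | succ i => simp

theorem eq_dupMap_skipMap (x : Fin (m + 2) → ℝ) :
    x = dupMap m (skipMap m x) + (x 1 - x 0) • Pi.single 1 1 := by
  ext i
  cases i using Fin.cases with
  | zero => simp
  | succ i =>
    cases i using Fin.cases with
    | zero => simp
    | succ i => simp [Fin.ext_iff]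

@[simp] theorem excess_dupMap (v : Fin (m + 1) → ℝ) :
    excess (m + 1) (dupMap m v) = excess m v := by
  simp only [excess_apply, dupMap_succ, dupMap_zero]
  rw [Fin.sum_univ_succ]
  push_cast
  ring

@[simp] theorem excess_single_one : excess (m + 1) (Pi.single 1 1) = -1 := by
  simp only [excess_apply]
  rw [Fin.sum_univ_succ]
  simp [Fin.ext_iff]

theorem single_zero_ne : (Pi.single 0 1 : Fin (m + 2) → ℝ) 1 = 0 := by simp

theorem tailMap_mem_integerLattice {x : Fin (m + 1) → ℝ} (hx : x ∈ integerLattice (m + 1)) :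
    tailMap m x ∈ integerLattice m := fun i => hx i.succ

theorem skipMap_mem_integerLattice {x : Fin (m + 2) → ℝ} (hx : x ∈ integerLattice (m + 2)) :
    skipMap m x ∈ integerLattice (m + 1) := fun i => by
  cases i using Fin.cases with
  | zero => exact hx 0
  | succ i => exact hx i.succ.succ

theorem dupMap_mem_integerLattice {x : Fin (m + 1) → ℝ} (hx : x ∈ integerLattice (m + 1)) :
    dupMap m x ∈ integerLattice (m + 2) := fun i => by
  cases i using Fin.cases with
  | zero => exact hx 0
  | succ i => exact hx i

end Maps

/-- The point over `v` at height `k`. -/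
noncomputable def heightPoint {m : ℕ} (v : Fin (m + 1) → ℝ) (k : ℕ) : Fin (m + 2) → ℝ :=
  dupMap m v + (k : ℝ) • Pi.single 1 1

section HeightPoint

variable {m : ℕ}

@[simp] theorem heightPoint_zero (v : Fin (m + 1) → ℝ) (k : ℕ) : heightPoint v k 0 = v 0 := by
  simp [heightPoint]

@[simp] theorem heightPoint_one (v : Fin (m + 1) → ℝ) (k : ℕ) :
    heightPoint v k 1 = v 0 + k := by
  simp [heightPoint]

@[simp] theorem skipMap_heightPoint (v : Fin (m + 1) → ℝ) (k : ℕ) :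
    skipMap m (heightPoint v k) = v := by
  simp [heightPoint]

@[simp] theorem tailMap_heightPoint (v : Fin (m + 1) → ℝ) (k : ℕ) :
    tailMap (m + 1) (heightPoint v k) = v + (k : ℝ) • Pi.single 0 1 := by
  simp [heightPoint]

theorem heightPoint_inj {v v' : Fin (m + 1) → ℝ} {k k' : ℕ} :
    heightPoint v k = heightPoint v' k' ↔ v = v' ∧ k = k' := by
  refine ⟨fun h => ?_, by rintro ⟨rfl, rfl⟩; rfl⟩
  have h1 : v = v' := by simpa using congrArg (skipMap m) h
  subst h1
  have h2 := congrFun h 1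
  simp only [heightPoint_one, add_right_inj, Nat.cast_inj] at h2
  exact ⟨rfl, h2⟩

theorem heightPoint_ne {v : Fin (m + 1) → ℝ} (hv : v 0 = 1) (k : ℕ) :
    heightPoint v k ≠ Pi.single 0 1 := fun h => by
  have := congrFun h 1
  rw [single_zero_ne, heightPoint_one, hv] at this
  have : (0 : ℝ) ≤ k := Nat.cast_nonneg k
  linarith

theorem heightPoint_mem_gapCone {v : Fin (m + 1) → ℝ} (hv : v ∈ gapCone m) {k : ℕ}
    (hk : (k : ℝ) ≤ excess m v) : heightPoint v k ∈ gapCone (m + 1) := by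
  refine mem_gapCone_succ.2 ⟨?_, ?_⟩
  · rw [tailMap_heightPoint]
    exact Submodule.add_mem _ hv ((gapCone m).smul_mem (Nat.cast_nonneg k)
      (single_zero_mem_gapCone m))
  · simpa [heightPoint] using hk

/-- This describes the part `x 0 ≤ x 1` as a chimney: writing `x` as `dupMap` of its skipped vector
plus `(x 1 - x 0) • e₁`, the condition `0 ≤ excess (m + 1) x` becomes an upper bound on the height.
-/
theorem skipMap_mem_gapCone {x : Fin (m + 2) → ℝ} (hx : x ∈ gapCone (m + 1)) (h : x 0 ≤ x 1) :
    skipMap m x ∈ gapCone m ∧ x 1 - x 0 ≤ excess m (skipMap m x) := by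
  obtain ⟨h1, h2⟩ := mem_gapCone_succ.1 hx
  have h3 : x 1 - x 0 ≤ excess m (skipMap m x) := by
    rw [eq_dupMap_skipMap x] at h2
    simp only [map_add, map_smul, excess_dupMap, excess_single_one, smul_eq_mul] at h2
    linarith
  refine ⟨?_, h3⟩
  cases m with
  | zero =>
    rw [mem_gapCone_zero] at h1 ⊢
    simp [excess_apply] at h1 h3 ⊢
    linarith
  | succ m =>
    rw [mem_gapCone_succ] at h1 ⊢
    exact ⟨h1.1, by linarith⟩

theorem heightPoint_mem_integerLattice {v : Fin (m + 1) → ℝ} (hv : v ∈ integerLattice (m + 1))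
    (k : ℕ) : heightPoint v k ∈ integerLattice (m + 2) := by
  refine Submodule.add_mem _ (dupMap_mem_integerLattice hv) ?_
  rw [Nat.cast_smul_eq_nsmul]
  exact Submodule.smul_of_tower_mem _ k (single_mem_integerLattice 1)

end HeightPoint

/-! ### Staircases -/

section Staircase

variable {E : Type*} [DecidableEq E] (r u : E → ℕ)

/-- Heights of a staircase over vertices ordered by `r`: vertices before `i` are raised fully,
`i` is raised to `t`, and the later vertices are not raised. -/
def stairHeight (i : E) (t : ℕ) (v : E) : ℕ :=
  if r v < r i then u v else if v = i then t else 0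

@[simp] theorem stairHeight_self (i : E) (t : ℕ) : stairHeight r u i t i = t := by
  simp [stairHeight]

variable {r u}

theorem stairHeight_of_lt {i v : E} (h : r v < r i) (t : ℕ) : stairHeight r u i t v = u v := by
  simp [stairHeight, h]

theorem stairHeight_of_gt {i v : E} (h : r i < r v) (t : ℕ) : stairHeight r u i t v = 0 := by
  have : v ≠ i := by rintro rfl; exact lt_irrefl _ h
  simp [stairHeight, h.not_gt, this]

theorem stairHeight_le {i : E} {t : ℕ} (ht : t ≤ u i) (v : E) : stairHeight r u i t v ≤ u v := by
  unfold stairHeight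
  split_ifs with h1 h2
  · exact le_rfl
  · exact h2 ▸ ht
  · exact Nat.zero_le _

/-- The convex height functions `k ↦ k² + N r(v) k` induce the staircase triangulation. -/
theorem stairHeight_minimal {N i t : ℕ} {j k a : ℕ} (ht : 2 * t + 2 ≤ N) (hk : k ≤ a)
    (ha : 2 * a ≤ N) (f : ℕ → ℝ)
    (hf : ∀ k, f k = (k : ℝ) ^ 2 + N * j * k - (2 * t + 1 + N * i) * k) :
    (j < i → f a ≤ f k ∧ (k ≠ a → f a < f k)) ∧ (i < j → f 0 ≤ f k ∧ (k ≠ 0 → f 0 < f k)) ∧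
      (i = j → f t = f (t + 1) ∧ f t ≤ f k ∧ (k ≠ t → k ≠ t + 1 → f t < f k)) := by
  have ht' : (2 * t + 2 : ℝ) ≤ N := by exact_mod_cast ht
  have ha' : (2 * a : ℝ) ≤ N := by exact_mod_cast ha
  have hk' : (k : ℝ) ≤ a := by exact_mod_cast hk
  have hk0 : (0 : ℝ) ≤ k := Nat.cast_nonneg k
  have ht0 : (0 : ℝ) ≤ t := Nat.cast_nonneg t
  have hN : (0 : ℝ) ≤ N := Nat.cast_nonneg N
  refine ⟨fun h => ?_, fun h => ?_, fun h => ?_⟩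
  · have h' : (j + 1 : ℝ) ≤ i := by exact_mod_cast h
    -- Distinct ranks separate the slopes: the factor on the right is positive because `a + k ≤ 2 *
    -- a ≤ N`.
    have e : f k - f a = (a - k) * (N * (i - j) + (2 * t + 1) - a - k) := by rw [hf, hf]; ring
    have p : 0 < N * ((i : ℝ) - j) + (2 * t + 1) - a - k := by
      nlinarith [mul_le_mul_of_nonneg_left (by linarith : (1 : ℝ) ≤ i - j) hN]
    refine ⟨?_, fun hne => ?_⟩
    · have := mul_nonneg (sub_nonneg.2 hk') p.le
      linarith
    · have hlt : (k : ℝ) < a := by exact_mod_cast lt_of_le_of_ne hk hne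
      have := mul_pos (sub_pos.2 hlt) p
      linarith
  · have h' : (i + 1 : ℝ) ≤ j := by exact_mod_cast h
    have e : f k - f 0 = k * (k + N * (j - i) - (2 * t + 1)) := by
      rw [hf, hf]; push_cast; ring
    have p : 0 < k + N * ((j : ℝ) - i) - (2 * t + 1) := by
      nlinarith [mul_le_mul_of_nonneg_left (by linarith : (1 : ℝ) ≤ j - i) hN]
    refine ⟨?_, fun hne => ?_⟩
    · have := mul_nonneg hk0 p.le
      linarith
    · have hlt : (0 : ℝ) < k := by exact_mod_cast Nat.pos_of_ne_zero hne
      have := mul_pos hlt p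
      linarith
  · subst h
    -- The subtracted slope `2 * t + 1 + N * i` is that of the height function between `t` and `t +
    -- 1`, so exactly these two consecutive integers are minimizers.
    have e : f k - f t = ((k : ℝ) - t) * (k - (t + 1)) := by rw [hf, hf]; ring
    refine ⟨by rw [hf, hf]; push_cast; ring, ?_, fun h1 h2 => ?_⟩
    · rcases le_or_gt k t with h | h
      · have h : (k : ℝ) ≤ t := by exact_mod_cast h
        nlinarith
      · have h : (t + 1 : ℝ) ≤ k := by exact_mod_cast h
        nlinarith
    · rcases lt_or_gt_of_ne h1 with h | h
      · have h : (k : ℝ) < t := by exact_mod_cast h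
        nlinarith
      · have h : (t + 1 : ℝ) < k := by
          exact_mod_cast lt_of_le_of_ne (Nat.succ_le_of_lt h) (Ne.symm h2)
        nlinarith

/-- Locate `d` among the partial sums of `f` in the order given by `r`. -/
theorem exists_partial_sum (r : E → ℕ) {s : Finset E} (hr : Set.InjOn r s) {f : E → ℝ} {d : ℝ}
    (hd : 0 < d) (hds : d ≤ ∑ v ∈ s, f v) :
    ∃ i ∈ s, ∑ v ∈ s with r v < r i, f v < d ∧ d ≤ ∑ v ∈ s with r v < r i, f v + f i := by
  induction s using Finset.induction_on_max_value r with
  | empty => simp at hds; linarith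
  | insert a s ha hmax ih =>
    have hr' : Set.InjOn r s := hr.mono (by simp)
    by_cases hds' : d ≤ ∑ v ∈ s, f v
    · obtain ⟨i, hi, h1, h2⟩ := ih hr' hds'
      have : ({v ∈ insert a s | r v < r i} : Finset E) = {v ∈ s | r v < r i} := by
        rw [Finset.filter_insert, if_neg (hmax i hi).not_gt]
      exact ⟨i, by simp [hi], by rwa [this], by rwa [this]⟩
    · have : ({v ∈ insert a s | r v < r a} : Finset E) = s := by
        rw [Finset.filter_insert, if_neg (lt_irrefl _), Finset.filter_eq_self]
        refine fun v hv => lt_of_le_of_ne (hmax v hv) fun h => ha ?_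
        rwa [← hr (by simp [hv]) (by simp) h]
      refine ⟨a, by simp, by rw [this]; linarith, ?_⟩
      rw [this, add_comm]
      rwa [Finset.sum_insert ha] at hds

end Staircase

/-! ### Pyramids and staircase simplices -/

section Step

variable {m : ℕ}

/-- The pyramid over `s` with apex `e₀`. -/
noncomputable def pyramid (s : Finset (Fin (m + 1) → ℝ)) : Finset (Fin (m + 2) → ℝ) :=
  insert (Pi.single 0 1) (s.image fun v => heightPoint v 0)

/-- A simplex of the staircase triangulation over `s`. -/
noncomputable def stair (r u : (Fin (m + 1) → ℝ) → ℕ) (s : Finset (Fin (m + 1) → ℝ))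
    (i : Fin (m + 1) → ℝ) (t : ℕ) : Finset (Fin (m + 2) → ℝ) :=
  insert (heightPoint i (t + 1)) (s.image fun v => heightPoint v (stairHeight r u i t v))

/-- The maximal cones obtained from `𝓕` by adding pyramids and staircases. -/
def stepFacets (r u : (Fin (m + 1) → ℝ) → ℕ) (𝓕 : Set (Finset (Fin (m + 1) → ℝ))) :
    Set (Finset (Fin (m + 2) → ℝ)) :=
  pyramid '' 𝓕 ∪ {F | ∃ s ∈ 𝓕, ∃ i ∈ s, ∃ t < u i, F = stair r u s i t}

/-- The heights inducing the triangulation with maximal cones `stepFacets`. -/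
noncomputable def stepHeight (w : (Fin (m + 1) → ℝ) → ℝ) (r : (Fin (m + 1) → ℝ) → ℕ) (N : ℕ)
    (M γ : ℝ) (x : Fin (m + 2) → ℝ) : ℝ :=
  if x = Pi.single 0 1 then γ
  else M * w (skipMap m x) + ((x 1 - x 0) ^ 2 + N * r (skipMap m x) * (x 1 - x 0))

variable {r u : (Fin (m + 1) → ℝ) → ℕ} {s : Finset (Fin (m + 1) → ℝ)} {i v : Fin (m + 1) → ℝ}
  {t k : ℕ}

theorem mem_pyramid {x : Fin (m + 2) → ℝ} :
    x ∈ pyramid s ↔ x = Pi.single 0 1 ∨ ∃ v ∈ s, heightPoint v 0 = x := by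
  simp [pyramid]

theorem mem_stair {x : Fin (m + 2) → ℝ} :
    x ∈ stair r u s i t ↔ x = heightPoint i (t + 1) ∨
      ∃ v ∈ s, heightPoint v (stairHeight r u i t v) = x := by
  simp [stair]

theorem heightPoint_mem_pyramid (hv : v 0 = 1) : heightPoint v k ∈ pyramid s ↔ v ∈ s ∧ k = 0 := by
  simp only [mem_pyramid, heightPoint_ne hv, false_or, heightPoint_inj]
  constructor
  · rintro ⟨v, hvs, rfl, rfl⟩
    exact ⟨hvs, rfl⟩
  · rintro ⟨hv, rfl⟩
    exact ⟨v, hv, rfl, rfl⟩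

theorem heightPoint_mem_stair (hi : i ∈ s) : heightPoint v k ∈ stair r u s i t ↔
    v ∈ s ∧ (k = stairHeight r u i t v ∨ v = i ∧ k = t + 1) := by
  simp only [mem_stair, heightPoint_inj]
  constructor
  · rintro (⟨rfl, rfl⟩ | ⟨v, hv, rfl, rfl⟩)
    · exact ⟨hi, Or.inr ⟨rfl, rfl⟩⟩
    · exact ⟨hv, Or.inl rfl⟩
  · rintro ⟨hv, rfl | ⟨rfl, rfl⟩⟩
    · exact Or.inr ⟨v, hv, rfl, rfl⟩
    · exact Or.inl ⟨rfl, rfl⟩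

theorem card_pyramid (hs : ∀ v ∈ s, v 0 = 1) : (pyramid s).card = s.card + 1 := by
  rw [pyramid, Finset.card_insert_of_notMem, Finset.card_image_of_injective]
  · exact fun v v' h => (heightPoint_inj.1 h).1
  · simp only [Finset.mem_image, not_exists, not_and]
    exact fun v hv => heightPoint_ne (hs v hv) 0

theorem card_stair : (stair r u s i t).card = s.card + 1 := by
  rw [stair, Finset.card_insert_of_notMem, Finset.card_image_of_injective]
  · exact fun v v' h => (heightPoint_inj.1 h).1
  · simp only [Finset.mem_image, not_exists, not_and, heightPoint_inj]
    rintro v hv rfl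
    simp

theorem stepHeight_single {w : (Fin (m + 1) → ℝ) → ℝ} {N : ℕ} {M γ : ℝ} :
    stepHeight w r N M γ (Pi.single 0 1) = γ := if_pos rfl

theorem stepHeight_heightPoint {w : (Fin (m + 1) → ℝ) → ℝ} {N : ℕ} {M γ : ℝ} (hv : v 0 = 1) :
    stepHeight w r N M γ (heightPoint v k) = M * w v + ((k : ℝ) ^ 2 + N * r v * k) := by
  rw [stepHeight, if_neg (heightPoint_ne hv k)]
  simp

theorem le_span_pyramid (h : integerLattice (m + 1) ≤ Submodule.span ℤ (s : Set _)) :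
    integerLattice (m + 2) ≤ Submodule.span ℤ (pyramid s : Set (Fin (m + 2) → ℝ)) := by
  intro x hx
  have hdup : Submodule.span ℤ (s : Set (Fin (m + 1) → ℝ)) ≤
      (Submodule.span ℤ (pyramid s : Set (Fin (m + 2) → ℝ))).comap
        ((dupMap m).restrictScalars ℤ) := by
    refine Submodule.span_le.2 fun v hv => Submodule.subset_span ?_
    exact mem_pyramid.2 (Or.inr ⟨v, hv, by simp [heightPoint]⟩)
  obtain ⟨a, ha⟩ := hx 0
  obtain ⟨b, hb⟩ := hx 1
  rw [eq_dupMap_tailMap x]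
  refine Submodule.add_mem _ (hdup (h (tailMap_mem_integerLattice hx))) ?_
  rw [← ha, ← hb, ← Int.cast_sub, Int.cast_smul_eq_zsmul]
  exact Submodule.smul_mem _ _ (Submodule.subset_span (mem_pyramid.2 (Or.inl rfl)))

/-- The two points over `i` are consecutive and differ by `e₁`; subtracting multiples of `e₁` from
the other points recovers the doubled base, which spans the rest. -/
theorem le_span_stair (h : integerLattice (m + 1) ≤ Submodule.span ℤ (s : Set _)) (hi : i ∈ s) :
    integerLattice (m + 2) ≤ Submodule.span ℤ (stair r u s i t : Set (Fin (m + 2) → ℝ)) := by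
  intro x hx
  have hone : (Pi.single 1 1 : Fin (m + 2) → ℝ) ∈
      Submodule.span ℤ (stair r u s i t : Set (Fin (m + 2) → ℝ)) := by
    have : (Pi.single 1 1 : Fin (m + 2) → ℝ) = heightPoint i (t + 1) - heightPoint i t := by
      simp [heightPoint, add_smul]
    rw [this]
    refine Submodule.sub_mem _ (Submodule.subset_span ?_) (Submodule.subset_span ?_)
    · exact (heightPoint_mem_stair hi).2 ⟨hi, Or.inr ⟨rfl, rfl⟩⟩
    · exact (heightPoint_mem_stair hi).2 ⟨hi, Or.inl (by simp)⟩
  have hdup : Submodule.span ℤ (s : Set (Fin (m + 1) → ℝ)) ≤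
      (Submodule.span ℤ (stair r u s i t : Set (Fin (m + 2) → ℝ))).comap
        ((dupMap m).restrictScalars ℤ) := by
    refine Submodule.span_le.2 fun v hv => ?_
    have : dupMap m v = heightPoint v (stairHeight r u i t v) -
        (stairHeight r u i t v : ℤ) • Pi.single 1 1 := by
      simp [heightPoint, Nat.cast_smul_eq_nsmul]
    change dupMap m v ∈ Submodule.span ℤ (stair r u s i t : Set (Fin (m + 2) → ℝ))
    rw [this]
    exact Submodule.sub_mem _
      (Submodule.subset_span ((heightPoint_mem_stair hi).2 ⟨hv, Or.inl rfl⟩))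
      (Submodule.smul_mem _ _ hone)
  obtain ⟨a, ha⟩ := hx 0
  obtain ⟨b, hb⟩ := hx 1
  rw [eq_dupMap_skipMap x]
  refine Submodule.add_mem _ (hdup (h (skipMap_mem_integerLattice hx))) ?_
  rw [← ha, ← hb, ← Int.cast_sub, Int.cast_smul_eq_zsmul]
  exact Submodule.smul_mem _ _ hone

theorem mem_hull_pyramid {x : Fin (m + 2) → ℝ}
    (hx : tailMap (m + 1) x ∈ PointedCone.hull ℝ (s : Set (Fin (m + 1) → ℝ))) (h : x 1 ≤ x 0) :
    x ∈ PointedCone.hull ℝ (pyramid s : Set (Fin (m + 2) → ℝ)) := by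
  have hdup : PointedCone.hull ℝ (s : Set (Fin (m + 1) → ℝ)) ≤
      (PointedCone.hull ℝ (pyramid s : Set (Fin (m + 2) → ℝ))).comap (dupMap m) := by
    refine Submodule.span_le.2 fun v hv => Submodule.subset_span ?_
    exact mem_pyramid.2 (Or.inr ⟨v, hv, by simp [heightPoint]⟩)
  rw [eq_dupMap_tailMap x]
  exact Submodule.add_mem _ (hdup hx) (PointedCone.smul_mem _ (sub_nonneg.2 h)
    (Submodule.subset_span (mem_pyramid.2 (Or.inl rfl))))

/-- The total height `x 1 - x 0` is spent on the base vertices in the order `r`, where `v` can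
absorb at most `c v * u v`. The vertex at which the height runs out is `i`, and the remainder there
lies between two consecutive levels. -/
theorem exists_mem_hull_stair {x : Fin (m + 2) → ℝ} (hr : Set.InjOn r s)
    (hx : skipMap m x ∈ PointedCone.hull ℝ (s : Set (Fin (m + 1) → ℝ)))
    (hu : ∀ v ∈ s, (u v : ℝ) = excess m v) (h : x 0 < x 1)
    (hle : x 1 - x 0 ≤ excess m (skipMap m x)) :
    ∃ i ∈ s, ∃ t < u i, x ∈ PointedCone.hull ℝ (stair r u s i t : Set (Fin (m + 2) → ℝ)) := by
  obtain ⟨c, hc, hcx⟩ := mem_hull_finset.1 hx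
  have hsum : x 1 - x 0 ≤ ∑ v ∈ s, c v * u v := by
    refine hle.trans_eq ?_
    rw [← hcx, map_sum]
    exact Finset.sum_congr rfl fun v hv => by rw [map_smul, smul_eq_mul, hu v hv]
  obtain ⟨i, hi, h1, h2⟩ := exists_partial_sum r hr (sub_pos.2 h) hsum
  set A := ∑ v ∈ s with r v < r i, c v * u v with hA
  have hci : 0 < c i := by
    rcases (hc i hi).eq_or_lt with h0 | h0
    · rw [← h0] at h2; linarith
    · exact h0
  obtain ⟨d, hd⟩ : ∃ d, d * c i = x 1 - x 0 - A := ⟨(x 1 - x 0 - A) / c i, by field_simp⟩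
  have hd0 : 0 < d := by
    by_contra! hneg
    have := mul_nonpos_of_nonpos_of_nonneg hneg hci.le
    linarith
  have hdu : d ≤ u i := by
    by_contra! hlt
    have := mul_lt_mul_of_pos_right hlt hci
    linarith
  -- Ceiling minus one rather than the floor, so that `d = u i` still yields `t < u i`.
  obtain ⟨t, ht⟩ : ∃ t, ⌈d⌉₊ = t + 1 :=
    ⟨⌈d⌉₊ - 1, (Nat.succ_pred_eq_of_pos (Nat.ceil_pos.2 hd0)).symm⟩
  have htd : (t : ℝ) < d := Nat.lt_ceil.1 (by omega)
  have hdt : d ≤ t + 1 := by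
    have := Nat.le_ceil d
    rw [ht] at this
    exact_mod_cast this
  have htu : t < u i := by
    have : (t : ℝ) < u i := htd.trans_le hdu
    exact_mod_cast this
  refine ⟨i, hi, t, htu, ?_⟩
  have hb : ∑ v ∈ s, c v * (stairHeight r u i t v : ℝ) = A + c i * t := by
    have e : ∀ v ∈ s, c v * (stairHeight r u i t v : ℝ) =
        (if r v < r i then c v * u v else 0) + if v = i then c i * t else 0 := by
      intro v hv
      rcases lt_trichotomy (r v) (r i) with hlt | heq | hgt
      · have : v ≠ i := by rintro rfl; exact lt_irrefl _ hlt
        simp [stairHeight, hlt, this]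
      · obtain rfl := hr hv hi heq
        simp
      · have : v ≠ i := by rintro rfl; exact lt_irrefl _ hgt
        simp [stairHeight, hgt.not_gt, this]
    rw [Finset.sum_congr rfl e, Finset.sum_add_distrib, ← Finset.sum_filter,
      Finset.sum_ite_eq' s i, if_pos hi]
  -- The weight `c i` is shared between levels `t` and `t + 1` in proportions `1 - (d - t)` and `d -
  -- t`, giving mean level `d`.
  have key : x = ∑ v ∈ s, (if v = i then c i * (1 - (d - t)) else c v) •
      heightPoint v (stairHeight r u i t v) + (c i * (d - t)) • heightPoint i (t + 1) := by
    have e : ∀ v ∈ s, (if v = i then c i * (1 - (d - t)) else c v) •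
        heightPoint v (stairHeight r u i t v) =
        (c v • dupMap m v + (c v * (stairHeight r u i t v : ℝ)) • Pi.single 1 1) -
          if v = i then (c i * (d - t)) • heightPoint i t else 0 := by
      intro v hv
      split_ifs with hvi
      · subst hvi
        simp only [stairHeight_self, heightPoint]
        module
      · simp only [heightPoint]
        module
    rw [Finset.sum_congr rfl e, Finset.sum_sub_distrib, Finset.sum_add_distrib,
      ← Finset.sum_smul, hb, Finset.sum_ite_eq' s i, if_pos hi]
    conv_lhs => rw [eq_dupMap_skipMap x, ← hcx, map_sum]
    simp only [map_smul]
    have hx10 : x 1 - x 0 = A + c i * d := by linarith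
    rw [hx10]
    simp only [heightPoint]
    push_cast
    module
  rw [key]
  refine Submodule.add_mem _ (Submodule.sum_mem _ fun v hv => PointedCone.smul_mem _ ?_
    (Submodule.subset_span ((heightPoint_mem_stair hi).2 ⟨hv, Or.inl rfl⟩)))
    (PointedCone.smul_mem _ (mul_nonneg hci.le (by linarith))
      (Submodule.subset_span ((heightPoint_mem_stair hi).2 ⟨hi, Or.inr ⟨rfl, rfl⟩⟩)))
  split_ifs
  · exact mul_nonneg hci.le (by linarith)
  · exact hc v hv

end Step

/-! ### Flagness of the refined triangulation -/

section StepFlag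

variable {m : ℕ} {r u : (Fin (m + 1) → ℝ) → ℕ} {𝓕 : Set (Finset (Fin (m + 1) → ℝ))}

theorem finite_stepFacets (h𝓕 : 𝓕.Finite) : (stepFacets r u 𝓕).Finite := by
  refine (h𝓕.image _).union ?_
  refine (h𝓕.biUnion fun s _ => s.finite_toSet.biUnion fun i _ =>
    (Finset.range (u i)).finite_toSet.image (stair r u s i)).subset ?_
  rintro F ⟨s, hs, i, hi, t, ht, rfl⟩
  simp only [Set.mem_iUnion, Set.mem_image]
  exact ⟨s, hs, i, hi, t, by simpa using ht, rfl⟩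

theorem mem_stepFacets_cases {F : Finset (Fin (m + 2) → ℝ)} (hF : F ∈ stepFacets r u 𝓕)
    {x : Fin (m + 2) → ℝ} (hx : x ∈ F) :
    x = Pi.single 0 1 ∨ ∃ s ∈ 𝓕, ∃ v ∈ s, ∃ k ≤ u v, heightPoint v k = x := by
  rcases hF with ⟨s, hs, rfl⟩ | ⟨s, hs, i, hi, t, ht, rfl⟩
  · rcases mem_pyramid.1 hx with h | ⟨v, hv, h⟩
    · exact Or.inl h
    · exact Or.inr ⟨s, hs, v, hv, 0, Nat.zero_le _, h⟩
  · rcases mem_stair.1 hx with rfl | ⟨v, hv, h⟩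
    · exact Or.inr ⟨s, hs, i, hi, t + 1, ht, rfl⟩
    · exact Or.inr ⟨s, hs, v, hv, _, stairHeight_le ht.le v, h⟩

theorem exists_facet_of_heightPoint_mem {v v' : Fin (m + 1) → ℝ} (hv : v 0 = 1) (hv' : v' 0 = 1) {k k' : ℕ}
    (h : ∃ F ∈ stepFacets r u 𝓕, heightPoint v k ∈ F ∧ heightPoint v' k' ∈ F) :
    ∃ s ∈ 𝓕, v ∈ s ∧ v' ∈ s := by
  obtain ⟨F, ⟨s, hs, rfl⟩ | ⟨s, hs, i, hi, t, ht, rfl⟩, h1, h2⟩ := h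
  · exact ⟨s, hs, ((heightPoint_mem_pyramid hv).1 h1).1, ((heightPoint_mem_pyramid hv').1 h2).1⟩
  · exact ⟨s, hs, ((heightPoint_mem_stair hi).1 h1).1, ((heightPoint_mem_stair hi).1 h2).1⟩

/-- A positive height over `i` rules out a pyramid and forces the turning vertex `j` of the common
staircase to come no earlier than `i`. Vertices before `i` are then fully raised, and the heights
over `i` itself can differ by at most one. -/
theorem height_eq_of_compatible {i v : Fin (m + 1) → ℝ} (hi : i 0 = 1) {l k : ℕ}
    (hl : 0 < l)
    (h : ∃ F ∈ stepFacets r u 𝓕, heightPoint i l ∈ F ∧ heightPoint v k ∈ F)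
    (hgt : r i < r v → k = 0) (heq : v = i → k ≤ l) (hr : r v = r i → v = i) :
    k = stairHeight r u i (l - 1) v ∨ v = i ∧ k = l - 1 + 1 := by
  obtain ⟨F, ⟨s, hs, rfl⟩ | ⟨s, hs, j, hj, t, ht, rfl⟩, h1, h2⟩ := h
  · have := ((heightPoint_mem_pyramid hi).1 h1).2
    omega
  · have h1 := ((heightPoint_mem_stair hj).1 h1).2
    have h2 := ((heightPoint_mem_stair hj).1 h2).2
    rcases lt_trichotomy (r v) (r i) with hlt | he | hg
    · left
      rw [stairHeight_of_lt hlt]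
      have hij : r i ≤ r j := by
        by_contra! hji
        rw [stairHeight_of_gt hji] at h1
        rcases h1 with h1 | ⟨rfl, -⟩
        · omega
        · exact lt_irrefl _ hji
      have hvj : r v < r j := hlt.trans_le hij
      rw [stairHeight_of_lt hvj] at h2
      rcases h2 with h2 | ⟨rfl, -⟩
      · exact h2
      · exact absurd hvj (lt_irrefl _)
    · obtain rfl := hr he
      have := heq rfl
      rw [stairHeight_self]
      by_cases hvj : v = j
      · subst hvj
        rw [stairHeight_self] at h1 h2
        simp only [true_and] at *
        omega
      · simp only [hvj, false_and, or_false] at h1 h2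
        right
        exact ⟨rfl, by omega⟩
    · left
      rw [stairHeight_of_gt hg, hgt hg]

/-- A clique projects to a clique of the base, hence lies over one simplex `s`. If nothing is raised
it fits in the pyramid over `s`; otherwise it fits in the staircase simplex turning at the last
raised vertex `i`, with upper level the greatest height `l` occurring over `i`. -/
theorem flag_stepFacets (hone : ∀ s ∈ 𝓕, ∀ v ∈ s, v 0 = 1)
    (hr : Set.InjOn r {v | ∃ s ∈ 𝓕, v ∈ s})
    (hflag : ∀ t : Finset (Fin (m + 1) → ℝ),
      (∀ a ∈ t, ∀ b ∈ t, ∃ s ∈ 𝓕, a ∈ s ∧ b ∈ s) → ∃ s ∈ 𝓕, t ⊆ s)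
    {T : Finset (Fin (m + 2) → ℝ)}
    (hT : ∀ a ∈ T, ∀ b ∈ T, ∃ F ∈ stepFacets r u 𝓕, a ∈ F ∧ b ∈ F) :
    ∃ F ∈ stepFacets r u 𝓕, T ⊆ F := by
  classical
  have hform : ∀ x ∈ T, x ≠ Pi.single 0 1 →
      ∃ s ∈ 𝓕, ∃ v ∈ s, ∃ k ≤ u v, heightPoint v k = x := by
    intro x hx hx0
    obtain ⟨F, hF, hxF, -⟩ := hT x hx x hx
    exact (mem_stepFacets_cases hF hxF).resolve_left hx0
  obtain ⟨s, hs, hTs⟩ : ∃ s ∈ 𝓕, (T.erase (Pi.single 0 1)).image (skipMap m) ⊆ s := by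
    refine hflag _ fun a ha b hb => ?_
    simp only [Finset.mem_image, Finset.mem_erase] at ha hb
    obtain ⟨x, ⟨hx0, hx⟩, rfl⟩ := ha
    obtain ⟨y, ⟨hy0, hy⟩, rfl⟩ := hb
    obtain ⟨s, hs, v, hv, k, -, rfl⟩ := hform x hx hx0
    obtain ⟨s', hs', v', hv', k', -, rfl⟩ := hform y hy hy0
    simp only [skipMap_heightPoint]
    exact exists_facet_of_heightPoint_mem (hone s hs v hv) (hone s' hs' v' hv') (hT _ hx _ hy)
  have hT' : ∀ x ∈ T, x ≠ Pi.single 0 1 →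
      ∃ v ∈ s, ∃ k ≤ u v, heightPoint v k = x := by
    intro x hx hx0
    obtain ⟨s', hs', v, hv, k, hk, rfl⟩ := hform x hx hx0
    exact ⟨v, hTs (Finset.mem_image.2 ⟨_, Finset.mem_erase.2 ⟨hx0, hx⟩, skipMap_heightPoint v k⟩),
      k, hk, rfl⟩
  by_cases hz : ∀ v ∈ s, ∀ k, heightPoint v k ∈ T → k = 0
  · refine ⟨pyramid s, Or.inl ⟨s, hs, rfl⟩, fun x hx => ?_⟩
    by_cases hx0 : x = Pi.single 0 1
    · exact mem_pyramid.2 (Or.inl hx0)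
    · obtain ⟨v, hv, k, hk, rfl⟩ := hT' x hx hx0
      exact (heightPoint_mem_pyramid (hone s hs v hv)).2 ⟨hv, hz v hv k hx⟩
  · push Not at hz
    obtain ⟨i₀, hi₀, k₀, hk₀, hk₀'⟩ := hz
    -- The apex shares a facet only with points of height zero.
    have hapex : Pi.single 0 1 ∉ T := by
      intro h0
      obtain ⟨F, ⟨s', hs', rfl⟩ | ⟨s', hs', i, hi, t, ht, rfl⟩, h1, h2⟩ := hT _ h0 _ hk₀
      · exact hk₀' ((heightPoint_mem_pyramid (hone s hs i₀ hi₀)).1 h2).2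
      · rcases mem_stair.1 h1 with h | ⟨v, hv, h⟩
        · exact heightPoint_ne (hone s' hs' i hi) _ h.symm
        · exact heightPoint_ne (hone s' hs' v hv) _ h
    obtain ⟨i, hi, himax⟩ := Finset.exists_max_image
      {v ∈ s | ∃ k, heightPoint v k ∈ T ∧ k ≠ 0} r ⟨i₀, by simpa using ⟨hi₀, k₀, hk₀, hk₀'⟩⟩
    obtain ⟨his, k₁, hk₁, hk₁'⟩ := Finset.mem_filter.1 hi
    have hbound : ∀ v k, heightPoint v k ∈ T → v ∈ s ∧ k ≤ u v := by
      intro v k hvk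
      obtain ⟨v', hv', k', hk', he⟩ := hT' _ hvk fun h => hapex (h ▸ hvk)
      obtain ⟨rfl, rfl⟩ := heightPoint_inj.1 he
      exact ⟨hv', hk'⟩
    obtain ⟨l, hl, hlmax⟩ := Finset.exists_max_image
      {k ∈ Finset.range (u i + 1) | heightPoint i k ∈ T} id
      ⟨k₁, by simpa [Nat.lt_succ_iff] using ⟨(hbound i k₁ hk₁).2, hk₁⟩⟩
    obtain ⟨hl1, hl2⟩ := Finset.mem_filter.1 hl
    have hlm : ∀ k, heightPoint i k ∈ T → k ≤ l := fun k hk => hlmax k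
      (Finset.mem_filter.2 ⟨Finset.mem_range.2 (Nat.lt_succ_of_le (hbound i k hk).2), hk⟩)
    have hlpos : 0 < l := (Nat.pos_of_ne_zero hk₁').trans_le (hlm k₁ hk₁)
    have hlu := (hbound i l hl2).2
    refine ⟨stair r u s i (l - 1), Or.inr ⟨s, hs, i, his, l - 1, by omega, rfl⟩, fun x hx => ?_⟩
    obtain ⟨v, hv, k, hk, rfl⟩ := hT' x hx fun h => hapex (h ▸ hx)
    refine (heightPoint_mem_stair his).2 ⟨hv, height_eq_of_compatible (hone s hs i his) hlpos
      (hT _ hl2 _ hx) (fun hlt => ?_) (fun he => ?_) fun he => hr ⟨s, hs, hv⟩ ⟨s, hs, his⟩ he⟩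
    · by_contra hk0
      exact absurd (himax v (Finset.mem_filter.2 ⟨hv, k, hx, hk0⟩)) (not_le.2 hlt)
    · subst he
      exact hlm k hx

end StepFlag

/-- The linear functional `x₁ - x₀`. -/
def slopeMap (m : ℕ) : (Fin (m + 2) → ℝ) →ₗ[ℝ] ℝ :=
  (LinearMap.proj 1 : (Fin (m + 2) → ℝ) →ₗ[ℝ] ℝ) - LinearMap.proj 0

@[simp] theorem slopeMap_apply {m : ℕ} (x : Fin (m + 2) → ℝ) : slopeMap m x = x 1 - x 0 := rfl

/-! ### The induction step and the choice of heights -/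

namespace IsGradedTriangulation

variable {m : ℕ} {𝓕 : Set (Finset (Fin (m + 1) → ℝ))} {w : (Fin (m + 1) → ℝ) → ℝ}

theorem exists_floor_excess {v : Fin (m + 1) → ℝ} (hv : v ∈ integerLattice (m + 1))
    (hv' : v ∈ gapCone m) : (⌊excess m v⌋₊ : ℝ) = excess m v := by
  choose z hz using hv
  have h0 := excess_nonneg hv'
  have : excess m v = ((m * z 0 - ∑ i : Fin m, z i.succ : ℤ) : ℝ) := by
    rw [excess_apply]
    push_cast
    simp [hz]
  rw [this] at h0 ⊢
  obtain ⟨k, hk⟩ := Int.eq_ofNat_of_zero_le (Int.cast_nonneg_iff.1 h0)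
  rw [hk]
  simp

/-- The real work is `supporting`. The constants are fixed in the order `N`, `β`, `M`, `γ`: `N`
separates the vertical slopes of different vertices, `M` makes the old heights dominate so that the
base subdivision is refined, and `γ` creates the crease along `x 0 = x 1`. Finiteness of the data
turns each requirement into a bound satisfied by all large values. -/
theorem step (h : IsGradedTriangulation (gapCone m : Set (Fin (m + 1) → ℝ)) (LinearMap.proj 0) 𝓕 w) :
    ∃ 𝓕' w', IsGradedTriangulation (gapCone (m + 1) : Set (Fin (m + 2) → ℝ)) (LinearMap.proj 0)
      𝓕' w' := by
  set V : Set (Fin (m + 1) → ℝ) := {v | ∃ s ∈ 𝓕, v ∈ s} with hV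
  have hVfin : V.Finite := by
    refine (h.finite.biUnion fun s _ => s.finite_toSet).subset ?_
    rintro v ⟨s, hs, hv⟩
    exact Set.mem_biUnion hs hv
  obtain ⟨r, hr⟩ := Set.countable_iff_exists_injOn.1 hVfin.countable
  set u : (Fin (m + 1) → ℝ) → ℕ := fun v => ⌊excess m v⌋₊ with hu_def
  have hu : ∀ s ∈ 𝓕, ∀ v ∈ s, (u v : ℝ) = excess m v := fun s hs v hv =>
    exists_floor_excess (h.mem_lattice s hs v hv) (h.subset s hs v hv)
  have hone : ∀ s ∈ 𝓕, ∀ v ∈ s, v 0 = 1 := fun s hs v hv => h.degree_eq s hs v hv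
  obtain ⟨B, hB⟩ := (hVfin.image u).bddAbove
  have hB : ∀ v ∈ V, u v ≤ B := fun v hv => hB ⟨v, hv, rfl⟩
  set N := 2 * B with hN
  have hsupp := h.supporting
  choose! g hgs hg using hsupp
  -- Since `s` is a basis, a linear `β` can be prescribed on it: its value at `v` is the minimum
  -- over `k` of the height function tilted by the slope of the step from `t` to `t + 1` over `i`.
  have hβ : ∀ s ∈ 𝓕, ∀ i : Fin (m + 1) → ℝ, ∀ t : ℕ, ∃ β : (Fin (m + 1) → ℝ) →ₗ[ℝ] ℝ,
      ∀ v ∈ s, β v = ((stairHeight r u i t v : ℝ) ^ 2 + N * r v * stairHeight r u i t v -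
        (2 * t + 1 + N * r i) * stairHeight r u i t v) := fun s hs i t =>
    h.exists_functional hs _
  choose! β hβ using hβ
  have hM : ∀ᶠ M : ℝ in Filter.atTop, ∀ s ∈ 𝓕, ∀ i ∈ V, ∀ t ∈ Finset.range (u i), ∀ v ∈ V,
      ∀ k ∈ Finset.range (u v + 1), v ∉ s → β s i t v - ((k : ℝ) ^ 2 + N * r v * k -
        (2 * t + 1 + N * r i) * k) < M * (w v - g s v) := by
    rw [Filter.eventually_all_finite h.finite]
    intro s hs
    rw [Filter.eventually_all_finite hVfin]
    intro i hi
    rw [Filter.eventually_all_finset]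
    intro t _
    rw [Filter.eventually_all_finite hVfin]
    intro v hv
    rw [Filter.eventually_all_finset]
    intro k _
    by_cases hvs : v ∈ s
    · simp [hvs]
    · obtain ⟨s', hs', hv'⟩ := hv
      have hpos : 0 < w v - g s v := sub_pos.2 (hg s hs s' hs' v hv' hvs)
      filter_upwards [(Filter.tendsto_id.atTop_mul_const hpos).eventually_gt_atTop
        (β s i t v - ((k : ℝ) ^ 2 + N * r v * k - (2 * t + 1 + N * r i) * k))] with M hM _
      exact hM
  obtain ⟨M, hM, hM0⟩ := (hM.and (Filter.eventually_gt_atTop 0)).exists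
  have hγ : ∀ᶠ γ : ℝ in Filter.atTop, ∀ s ∈ 𝓕,
      (∀ i ∈ V, ∀ t ∈ Finset.range (u i), M * g s (Pi.single 0 1) + β s i t (Pi.single 0 1) -
        (2 * t + 1 + N * r i) < γ) ∧
      ∀ v ∈ V, ∀ k ∈ Finset.range (u v + 1), k ≠ 0 →
        M * (g s v + k * g s (Pi.single 0 1)) - (M * w v + ((k : ℝ) ^ 2 + N * r v * k)) < γ * k := by
    rw [Filter.eventually_all_finite h.finite]
    intro s hs
    refine Filter.Eventually.and ?_ ?_
    · rw [Filter.eventually_all_finite hVfin]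
      intro i hi
      rw [Filter.eventually_all_finset]
      exact fun t _ => Filter.eventually_gt_atTop _
    · rw [Filter.eventually_all_finite hVfin]
      intro v hv
      rw [Filter.eventually_all_finset]
      intro k _
      by_cases hk : k = 0
      · simp [hk]
      · have hpos : (0 : ℝ) < k := by exact_mod_cast Nat.pos_of_ne_zero hk
        filter_upwards [(Filter.tendsto_id.atTop_mul_const hpos).eventually_gt_atTop
          (M * (g s v + k * g s (Pi.single 0 1)) - (M * w v + ((k : ℝ) ^ 2 + N * r v * k)))]
          with γ hγ _
        exact hγ
  obtain ⟨γ, hγ⟩ := hγ.exists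
  have hVs : ∀ s ∈ 𝓕, ∀ v ∈ s, v ∈ V := fun s hs v hv => ⟨s, hs, hv⟩
  refine ⟨stepFacets r u 𝓕, stepHeight w r N M γ, ?_⟩
  refine
    { finite := finite_stepFacets h.finite
      card_eq := ?_
      mem_lattice := ?_
      le_span := ?_
      subset := ?_
      degree_eq := ?_
      cover := ?_
      supporting := ?_
      flag := fun T hT => flag_stepFacets hone hr h.flag hT }
  · rintro F (⟨s, hs, rfl⟩ | ⟨s, hs, i, hi, t, ht, rfl⟩)
    · rw [card_pyramid (hone s hs), h.card_eq s hs]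
    · rw [card_stair, h.card_eq s hs]
  · intro F hF x hx
    rcases mem_stepFacets_cases hF hx with rfl | ⟨s, hs, v, hv, k, hk, rfl⟩
    · exact single_mem_integerLattice 0
    · exact heightPoint_mem_integerLattice (h.mem_lattice s hs v hv) k
  · rintro F (⟨s, hs, rfl⟩ | ⟨s, hs, i, hi, t, ht, rfl⟩)
    · exact le_span_pyramid (h.le_span s hs)
    · exact le_span_stair (h.le_span s hs) hi
  · intro F hF x hx
    rcases mem_stepFacets_cases hF hx with rfl | ⟨s, hs, v, hv, k, hk, rfl⟩
    · exact single_zero_mem_gapCone (m + 1)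
    · refine heightPoint_mem_gapCone (h.subset s hs v hv) ?_
      rw [← hu s hs v hv]
      exact_mod_cast hk
  · intro F hF x hx
    rcases mem_stepFacets_cases hF hx with rfl | ⟨s, hs, v, hv, k, hk, rfl⟩
    · simp
    · simpa using hone s hs v hv
  · intro x hx
    rcases le_or_gt (x 1) (x 0) with h10 | h10
    · obtain ⟨s, hs, hxs⟩ := h.cover _ (mem_gapCone_succ.1 hx).1
      exact ⟨_, Or.inl ⟨s, hs, rfl⟩, mem_hull_pyramid hxs h10⟩
    · obtain ⟨h1, h2⟩ := skipMap_mem_gapCone hx h10.le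
      obtain ⟨s, hs, hxs⟩ := h.cover _ h1
      obtain ⟨i, hi, t, ht, hxt⟩ := exists_mem_hull_stair (hr.mono (hVs s hs)) hxs (hu s hs) h10 h2
      exact ⟨_, Or.inr ⟨s, hs, i, hi, t, ht, rfl⟩, hxt⟩
  · rintro F (⟨s, hs, rfl⟩ | ⟨s, hs, i, hi, t, ht, rfl⟩)
    -- `slopeMap` is `-1` at the apex, `0` on the doubled base and `k` at height `k`: the value at
    -- the apex is `γ`, and large `γ` pushes the functional below every raised point.
    · set G : (Fin (m + 2) → ℝ) →ₗ[ℝ] ℝ := M • (g s).comp (tailMap (m + 1)) - γ • slopeMap m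
        with hG_def
      have hG : ∀ (v : Fin (m + 1) → ℝ) (k : ℕ), G (heightPoint v k) =
          M * (g s v + k * g s (Pi.single 0 1)) - γ * k := by
        intro v k
        simp [hG_def]
      refine ⟨G, ?_, ?_⟩
      · intro x hx
        rcases mem_pyramid.1 hx with rfl | ⟨v, hv, rfl⟩
        · rw [stepHeight_single]
          simp [hG_def]
        · rw [stepHeight_heightPoint (hone s hs v hv), hG, ← hgs s hs v hv]
          simp
      · intro F hF x hx hxs
        rcases mem_stepFacets_cases hF hx with rfl | ⟨s', hs', v, hv, k, hk, rfl⟩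
        · exact absurd (mem_pyramid.2 (Or.inl rfl)) hxs
        rw [stepHeight_heightPoint (hone s' hs' v hv), hG]
        by_cases hk0 : k = 0
        · subst hk0
          have hvs : v ∉ s := fun hvs =>
            hxs ((heightPoint_mem_pyramid (hone s' hs' v hv)).2 ⟨hvs, rfl⟩)
          have := mul_lt_mul_of_pos_left (hg s hs s' hs' v hv hvs) hM0
          simpa using this
        · have := (hγ s hs).2 v ⟨s', hs', hv⟩ k (by simpa [Nat.lt_succ_iff] using hk) hk0
          linarith
    -- Over `s`, comparing this functional with the heights is the minimization in
    -- `stairHeight_minimal`; away from `s` the choice of `M` decides, and at the apex the choice of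
    -- `γ`.
    · set G : (Fin (m + 2) → ℝ) →ₗ[ℝ] ℝ := (M • g s + β s i t).comp (skipMap m) +
        (2 * t + 1 + N * r i : ℝ) • slopeMap m with hG_def
      have hG : ∀ (v : Fin (m + 1) → ℝ) (k : ℕ), G (heightPoint v k) =
          M * g s v + β s i t v + (2 * t + 1 + N * r i) * k := by
        intro v k
        simp [hG_def]
      have hiV := hVs s hs i hi
      have hmin : ∀ v ∈ V, ∀ k ≤ u v, _ := fun v hv k hk =>
        stairHeight_minimal (N := N) (i := r i) (t := t) (j := r v) (k := k) (a := u v)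
          (by have := hB i hiV; omega) hk (by have := hB v hv; omega) _ fun _ => rfl
      refine ⟨G, ?_, ?_⟩
      · intro x hx
        rcases mem_stair.1 hx with rfl | ⟨v, hv, rfl⟩
        · rw [stepHeight_heightPoint (hone s hs i hi), hG, hβ s hs i t i hi, hgs s hs i hi,
            stairHeight_self]
          have := ((hmin i hiV t ht.le).2.2 rfl).1
          push_cast at this ⊢
          linarith
        · rw [stepHeight_heightPoint (hone s hs v hv), hG, hβ s hs i t v hv, hgs s hs v hv]
          ring
      · intro F hF x hx hxs
        rcases mem_stepFacets_cases hF hx with rfl | ⟨s', hs', v, hv, k, hk, rfl⟩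
        · rw [stepHeight_single]
          have := (hγ s hs).1 i hiV t (by simpa using ht)
          simp [hG_def]
          linarith
        rw [stepHeight_heightPoint (hone s' hs' v hv), hG]
        by_cases hvs : v ∈ s
        · rw [hβ s hs i t v hvs, hgs s hs v hvs]
          have hnot := fun hh => hxs ((heightPoint_mem_stair hi).2 ⟨hvs, hh⟩)
          have hm := hmin v ⟨s', hs', hv⟩ k hk
          rcases lt_trichotomy (r v) (r i) with hlt | he | hgt
          · rw [stairHeight_of_lt hlt] at hnot ⊢
            have := (hm.1 hlt).2 fun hh => hnot (Or.inl hh)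
            linarith
          · obtain rfl := hr ⟨s', hs', hv⟩ hiV he
            rw [stairHeight_self] at hnot ⊢
            have := (hm.2.2 rfl).2.2 (fun hh => hnot (Or.inl hh)) fun hh => hnot (Or.inr ⟨rfl, hh⟩)
            linarith
          · rw [stairHeight_of_gt hgt] at hnot ⊢
            have := (hm.2.1 hgt).2 fun hh => hnot (Or.inl hh)
            linarith
        · have := hM s hs i hiV t (by simpa using ht) v ⟨s', hs', hv⟩ k
            (by simpa [Nat.lt_succ_iff] using hk) hvs
          linarith

end IsGradedTriangulation

theorem exists_isGradedTriangulation_gapCone (m : ℕ) :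
    ∃ 𝓕 w, IsGradedTriangulation (gapCone m : Set (Fin (m + 1) → ℝ)) (LinearMap.proj 0) 𝓕 w := by
  induction m with
  | zero =>
    have hx : ∀ x : Fin 1 → ℝ, x = x 0 • Pi.single 0 1 := fun x => by
      ext i
      rw [Subsingleton.elim i 0]
      simp
    refine ⟨{{Pi.single 0 1}}, fun _ => 1, ?_⟩
    refine
      { finite := Set.finite_singleton _
        card_eq := by simp
        mem_lattice := by simpa using single_mem_integerLattice 0
        le_span := ?_
        subset := by simpa using single_zero_mem_gapCone 0
        degree_eq := by simp
        cover := ?_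
        supporting := ?_
        flag := ?_ }
    · rintro s rfl x hxl
      obtain ⟨z, hz⟩ := hxl 0
      rw [hx x, ← hz, Int.cast_smul_eq_zsmul]
      exact Submodule.smul_mem _ _ (Submodule.subset_span (by simp))
    · intro x hxc
      refine ⟨_, rfl, ?_⟩
      rw [hx x]
      exact PointedCone.smul_mem _ (mem_gapCone_zero.1 hxc) (Submodule.subset_span (by simp))
    · rintro s rfl
      refine ⟨LinearMap.proj 0, by simp, ?_⟩
      rintro t rfl v hv hv'
      exact absurd hv hv'
    · intro t ht
      refine ⟨_, rfl, fun a ha => ?_⟩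
      obtain ⟨s, rfl, has, -⟩ := ht a ha a ha
      exact has
  | succ m ih =>
    obtain ⟨𝓕, w, h⟩ := ih
    exact h.step

/-! ### The simplex as a slice of the cone -/

theorem simplexVertex_zero (m : ℕ) : simplexVertex (m + 1) 0 = Pi.single 0 1 := by
  ext i
  cases i using Fin.cases <;> simp [simplexVertex]

theorem simplexVertex_apply_zero {m : ℕ} (j : Fin (m + 1)) : simplexVertex (m + 1) j 0 = 1 := by
  cases j using Fin.cases <;> simp [simplexVertex]

theorem simplexVertex_one (m : ℕ) : simplexVertex (m + 2) 1 =
    Pi.single 0 1 + (m + 1 : ℝ) • Pi.single 1 1 := by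
  ext i
  cases i using Fin.cases with
  | zero => simp [simplexVertex]
  | succ i =>
    cases i using Fin.cases with
    | zero => simp [simplexVertex]; ring
    | succ i => simp [simplexVertex, Fin.ext_iff, Fin.lt_def]

theorem simplexVertex_succ_succ {m : ℕ} (j : Fin m) : simplexVertex (m + 2) j.succ.succ =
    dupMap m (simplexVertex (m + 1) j.succ) := by
  ext i
  cases i using Fin.cases with
  | zero => simp [simplexVertex]
  | succ i =>
    simp only [dupMap_succ, simplexVertex, Fin.succ_lt_succ_iff, Fin.succ_inj, Fin.val_succ]
    push_cast
    congr 2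
    simp
    ring

theorem excess_single_zero (m : ℕ) : excess m (Pi.single 0 1) = m := by
  simp [excess_apply]

theorem excess_simplexVertex_succ {m : ℕ} (j : Fin m) :
    excess m (simplexVertex (m + 1) j.succ) = 0 := by
  induction m with
  | zero => exact j.elim0
  | succ m ih =>
    cases j using Fin.cases with
    | zero =>
      rw [Fin.succ_zero_eq_one, simplexVertex_one, map_add, map_smul, excess_single_zero,
        excess_single_one]
      simp
    | succ j => rw [simplexVertex_succ_succ, excess_dupMap, ih]

theorem simplexVertex_mem_gapCone {m : ℕ} (j : Fin (m + 1)) :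
    simplexVertex (m + 1) j ∈ gapCone m := by
  induction m with
  | zero => simp [mem_gapCone_zero, simplexVertex_apply_zero]
  | succ m ih =>
    cases j using Fin.cases with
    | zero =>
      rw [simplexVertex_zero]
      exact single_zero_mem_gapCone _
    | succ j =>
      refine mem_gapCone_succ.2 ⟨?_, (excess_simplexVertex_succ j).ge⟩
      cases j using Fin.cases with
      | zero =>
        rw [Fin.succ_zero_eq_one, simplexVertex_one, map_add, map_smul, tailMap_single_zero,
          tailMap_single_one, zero_add]
        exact PointedCone.smul_mem _ (by positivity) (single_zero_mem_gapCone m)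
      | succ j =>
        rw [simplexVertex_succ_succ, tailMap_dupMap]
        exact ih _

/-- Only `e₀` among the vertices has positive `excess`; the others lie on the facet where it
vanishes. Projecting along `e₀` onto that facet reduces a point to its tail, to which induction
applies. -/
theorem gapCone_le_hull (m : ℕ) :
    gapCone m ≤ PointedCone.hull ℝ (Set.range (simplexVertex (m + 1))) := by
  induction m with
  | zero =>
    intro x hx
    have : x = x 0 • simplexVertex 1 0 := by
      ext i
      cases i using Fin.cases with
      | zero => simp [simplexVertex_apply_zero]
      | succ i => exact i.elim0
    rw [this]
    exact PointedCone.smul_mem _ (mem_gapCone_zero.1 hx) (Submodule.subset_span ⟨0, rfl⟩)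
  | succ m ih =>
    intro x hx
    obtain ⟨h1, h2⟩ := mem_gapCone_succ.1 hx
    have hm : (0 : ℝ) < m + 1 := by positivity
    -- `Ψ v` is the point of the facet `excess (m + 1) = 0` with tail `v`; the factor arises because
    -- `e₀` has excess `m + 1`. It sends old vertices to new ones, the first up to a positive
    -- scalar.
    set Ψ : (Fin (m + 1) → ℝ) →ₗ[ℝ] (Fin (m + 2) → ℝ) :=
      dupMap m - (m + 1 : ℝ)⁻¹ • (excess m).smulRight (Pi.single 0 1) with hΨ
    have hmap : PointedCone.hull ℝ (Set.range (simplexVertex (m + 1))) ≤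
        (PointedCone.hull ℝ (Set.range (simplexVertex (m + 2)))).comap Ψ := by
      refine Submodule.span_le.2 ?_
      rintro _ ⟨j, rfl⟩
      change Ψ (simplexVertex (m + 1) j) ∈ PointedCone.hull ℝ (Set.range (simplexVertex (m + 2)))
      cases j using Fin.cases with
      | zero =>
        have : Ψ (simplexVertex (m + 1) 0) = (m + 1 : ℝ)⁻¹ • simplexVertex (m + 2) 1 := by
          rw [simplexVertex_zero, simplexVertex_one]
          have e : dupMap m (Pi.single 0 1) = Pi.single 0 1 + Pi.single 1 1 := by
            rw [eq_dupMap_skipMap (Pi.single 0 1 + Pi.single 1 1)]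
            simp
          simp only [hΨ, LinearMap.sub_apply, LinearMap.smul_apply, LinearMap.smulRight_apply,
            excess_single_zero, e]
          rw [smul_add, smul_smul, smul_smul, inv_mul_cancel₀ hm.ne', one_smul]
          have : (m + 1 : ℝ)⁻¹ * m = 1 - (m + 1 : ℝ)⁻¹ := by field_simp; ring
          rw [this]
          module
        rw [this]
        exact PointedCone.smul_mem _ (by positivity) (Submodule.subset_span ⟨1, rfl⟩)
      | succ j =>
        have : Ψ (simplexVertex (m + 1) j.succ) = simplexVertex (m + 2) j.succ.succ := by
          simp [hΨ, excess_simplexVertex_succ, simplexVertex_succ_succ]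
        rw [this]
        exact Submodule.subset_span ⟨_, rfl⟩
    have key : x = Ψ (tailMap (m + 1) x) +
        ((m + 1 : ℝ)⁻¹ * excess (m + 1) x) • simplexVertex (m + 2) 0 := by
      have e := congrArg (excess (m + 1)) (eq_dupMap_tailMap x)
      rw [map_add, map_smul, excess_dupMap, excess_single_zero, smul_eq_mul] at e
      conv_lhs => rw [eq_dupMap_tailMap x]
      simp only [hΨ, LinearMap.sub_apply, LinearMap.smul_apply, LinearMap.smulRight_apply,
        simplexVertex_zero]
      have : x 0 - x 1 = (m + 1 : ℝ)⁻¹ * excess (m + 1) x -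
          (m + 1 : ℝ)⁻¹ * excess m (tailMap (m + 1) x) := by
        rw [e]
        push_cast
        field_simp
        ring
      rw [this]
      module
    rw [key]
    exact Submodule.add_mem _ (hmap (ih h1)) (PointedCone.smul_mem _ (by positivity)
      (Submodule.subset_span ⟨0, rfl⟩))

theorem R_eq_slice (m : ℕ) :
    R (m + 1) = {x | x ∈ gapCone m ∧ (LinearMap.proj 0 : (Fin (m + 1) → ℝ) →ₗ[ℝ] ℝ) x = 1} := by
  classical
  have hrange : Set.range (simplexVertex (m + 1)) =
      ((Finset.univ.image (simplexVertex (m + 1)) : Finset (Fin (m + 1) → ℝ)) : Set _) := by simp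
  ext x
  rw [R, hrange, mem_convexHull_iff_mem_hull (δ := LinearMap.proj 0), ← hrange]
  · refine and_congr_left fun _ => ⟨fun h => ?_, fun h => gapCone_le_hull m h⟩
    refine (Submodule.span_le (p := gapCone m)).2 ?_ h
    rintro _ ⟨j, rfl⟩
    exact simplexVertex_mem_gapCone j
  · simp [simplexVertex_apply_zero]

/-! ### The lecture hall cone -/

theorem IsGradedTriangulation.map {n : ℕ} {C : PointedCone ℝ (Fin n → ℝ)}
    {δ : (Fin n → ℝ) →ₗ[ℝ] ℝ} {𝓕 : Set (Finset (Fin n → ℝ))} {w : (Fin n → ℝ) → ℝ}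
    (h : IsGradedTriangulation (C : Set (Fin n → ℝ)) δ 𝓕 w) (A : (Fin n → ℝ) ≃ₗ[ℝ] (Fin n → ℝ))
    (hA : ∀ x, A x ∈ integerLattice n ↔ x ∈ integerLattice n) :
    IsGradedTriangulation (C.map (A : (Fin n → ℝ) →ₗ[ℝ] (Fin n → ℝ)) : Set (Fin n → ℝ))
      (δ ∘ₗ A.symm) ((fun s => s.image A) '' 𝓕) (w ∘ A.symm) where
  finite := h.finite.image _
  card_eq := by
    rintro _ ⟨s, hs, rfl⟩
    rw [Finset.card_image_of_injective _ A.injective, h.card_eq s hs]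
  mem_lattice := by
    rintro _ ⟨s, hs, rfl⟩ _ hv
    obtain ⟨v, hvs, rfl⟩ := Finset.mem_image.1 hv
    exact (hA v).2 (h.mem_lattice s hs v hvs)
  le_span := by
    rintro _ ⟨s, hs, rfl⟩ x hx
    have hx' : A.symm x ∈ integerLattice n := (hA _).1 (by simpa using hx)
    have hmap : Submodule.span ℤ (s : Set (Fin n → ℝ)) ≤
        (Submodule.span ℤ ((s.image A : Finset (Fin n → ℝ)) : Set (Fin n → ℝ))).comap
          ((A : (Fin n → ℝ) →ₗ[ℝ] (Fin n → ℝ)).restrictScalars ℤ) :=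
      Submodule.span_le.2 fun v hv => Submodule.subset_span (Finset.mem_image_of_mem A hv)
    simpa using hmap (h.le_span s hs hx')
  subset := by
    rintro _ ⟨s, hs, rfl⟩ _ hv
    obtain ⟨v, hvs, rfl⟩ := Finset.mem_image.1 hv
    exact ⟨v, h.subset s hs v hvs, rfl⟩
  degree_eq := by
    rintro _ ⟨s, hs, rfl⟩ _ hv
    obtain ⟨v, hvs, rfl⟩ := Finset.mem_image.1 hv
    simpa using h.degree_eq s hs v hvs
  cover := by
    rintro _ ⟨x, hx, rfl⟩
    obtain ⟨s, hs, hxs⟩ := h.cover x hx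
    refine ⟨_, ⟨s, hs, rfl⟩, ?_⟩
    have hmap : PointedCone.hull ℝ (s : Set (Fin n → ℝ)) ≤
        (PointedCone.hull ℝ ((s.image A : Finset (Fin n → ℝ)) : Set (Fin n → ℝ))).comap
          (A : (Fin n → ℝ) →ₗ[ℝ] (Fin n → ℝ)) :=
      Submodule.span_le.2 fun v hv => Submodule.subset_span (Finset.mem_image_of_mem A hv)
    exact hmap hxs
  supporting := by
    rintro _ ⟨s, hs, rfl⟩
    obtain ⟨g, hgs, hg⟩ := h.supporting s hs
    refine ⟨g ∘ₗ A.symm, fun _ hv => ?_, ?_⟩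
    · obtain ⟨v, hvs, rfl⟩ := Finset.mem_image.1 hv
      simpa using hgs v hvs
    · rintro _ ⟨t, ht, rfl⟩ _ hv hvn
      obtain ⟨v, hvs, rfl⟩ := Finset.mem_image.1 hv
      simpa using hg t ht v hvs fun hvs' => hvn (Finset.mem_image_of_mem A hvs')
  flag := by
    intro t ht
    obtain ⟨s, hs, hts⟩ := h.flag (t.image A.symm) fun a ha b hb => by
      obtain ⟨a, hat, rfl⟩ := Finset.mem_image.1 ha
      obtain ⟨b, hbt, rfl⟩ := Finset.mem_image.1 hb
      obtain ⟨_, ⟨s, hs, rfl⟩, has, hbs⟩ := ht a hat b hbt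
      obtain ⟨a, has', rfl⟩ := Finset.mem_image.1 has
      obtain ⟨b, hbs', rfl⟩ := Finset.mem_image.1 hbs
      exact ⟨s, hs, by simpa using has', by simpa using hbs'⟩
    refine ⟨_, ⟨s, hs, rfl⟩, fun a ha => ?_⟩
    exact Finset.mem_image.2 ⟨A.symm a, hts (Finset.mem_image_of_mem _ ha), by simp⟩

/-- The linear map recovering a sequence from its gaps, listed from the last one. -/
def tailSums (n : ℕ) : (Fin n → ℝ) →ₗ[ℝ] (Fin n → ℝ) :=
  LinearMap.pi fun i => ∑ j with i.rev ≤ j, LinearMap.proj j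

theorem tailSums_apply {n : ℕ} (x : Fin n → ℝ) (i : Fin n) :
    tailSums n x i = ∑ j with i.rev ≤ j, x j := by
  simp [tailSums]

theorem tailSums_castSucc {n : ℕ} (x : Fin (n + 1) → ℝ) (i : Fin n) :
    tailSums (n + 1) x i.castSucc = tailSums n (tailMap n x) i := by
  simp only [tailSums_apply, Finset.sum_filter, Fin.sum_univ_succ, Fin.rev_castSucc,
    Fin.succ_le_succ_iff, tailMap_apply]
  simp

theorem tailSums_last {n : ℕ} (x : Fin (n + 1) → ℝ) :
    tailSums (n + 1) x (Fin.last n) = ∑ j, x j := by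
  simp [tailSums_apply]

theorem tailSums_mem_integerLattice {n : ℕ} {x : Fin n → ℝ} (hx : x ∈ integerLattice n) :
    tailSums n x ∈ integerLattice n := by
  intro i
  choose z hz using hx
  exact ⟨∑ j with i.rev ≤ j, z j, by simp [tailSums_apply, hz]⟩

/-- The gaps are solved for from the shortest prefix upwards, the new gap being the last entry minus
the sum of the gaps already found. No division occurs, so integrality is preserved. -/
theorem exists_tailSums_eq {n : ℕ} (y : Fin n → ℝ) :
    ∃ x, tailSums n x = y ∧ (y ∈ integerLattice n → x ∈ integerLattice n) := by
  induction n with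
  | zero => exact ⟨y, Subsingleton.elim _ _, id⟩
  | succ n ih =>
    obtain ⟨x, hx, hxl⟩ := ih fun i => y i.castSucc
    refine ⟨Fin.cons (y (Fin.last n) - ∑ j, x j) x, ?_, fun hy i => ?_⟩
    · ext i
      cases i using Fin.lastCases with
      | last => simp [tailSums_last, Fin.sum_univ_succ]
      | cast i =>
        rw [tailSums_castSucc]
        exact congrFun hx i
    · have hxl := hxl fun i => hy i.castSucc
      cases i using Fin.cases with
      | zero =>
        obtain ⟨a, ha⟩ := hy (Fin.last n)
        choose z hz using hxl
        exact ⟨a - ∑ j, z j, by simp [ha, hz]⟩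
      | succ i => simpa using hxl i

/-- `tailSums` as a linear equivalence. -/
noncomputable def tailSumsEquiv (n : ℕ) : (Fin n → ℝ) ≃ₗ[ℝ] (Fin n → ℝ) :=
  have hsurj : Function.Surjective (tailSums n) := fun y =>
    let ⟨x, hx, _⟩ := exists_tailSums_eq y
    ⟨x, hx⟩
  LinearEquiv.ofBijective (tailSums n) ⟨LinearMap.injective_iff_surjective.2 hsurj, hsurj⟩

theorem tailSumsEquiv_apply {n : ℕ} (x : Fin n → ℝ) : tailSumsEquiv n x = tailSums n x := rfl

theorem tailSumsEquiv_mem_integerLattice {n : ℕ} (x : Fin n → ℝ) :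
    tailSumsEquiv n x ∈ integerLattice n ↔ x ∈ integerLattice n := by
  refine ⟨fun h => ?_, tailSums_mem_integerLattice⟩
  obtain ⟨x', hx', hx'l⟩ := exists_tailSums_eq (tailSumsEquiv n x)
  rw [← (tailSumsEquiv n).injective hx']
  exact hx'l h

theorem mem_L_one {y : Fin 1 → ℝ} : y ∈ L 1 ↔ 0 ≤ y 0 := by
  constructor
  · exact fun h => by simpa using h.1 0
  · exact fun h => ⟨by simpa using h, Subsingleton.monotone _⟩

theorem mem_L_succ {m : ℕ} {y : Fin (m + 2) → ℝ} : y ∈ L (m + 2) ↔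
    (fun i : Fin (m + 1) => y i.castSucc) ∈ L (m + 1) ∧
      y (Fin.last m).castSucc / ((m : ℝ) + 1) ≤ y (Fin.last (m + 1)) / ((m : ℝ) + 1 + 1) := by
  have hL : ∀ (m : ℕ) (y : Fin (m + 1) → ℝ), y ∈ L (m + 1) ↔
      (∀ i : Fin (m + 1), 0 ≤ y i / ((i : ℕ) + 1)) ∧
      ∀ i : Fin m, y i.castSucc / (((i : ℕ) : ℝ) + 1) ≤ y i.succ / (((i : ℕ) : ℝ) + 1 + 1) := by
    intro m y
    refine and_congr_right fun _ => ?_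
    rw [Fin.monotone_iff_le_succ]
    simp
  rw [hL, hL]
  constructor
  · rintro ⟨h1, h2⟩
    exact ⟨⟨fun i => by simpa using h1 i.castSucc, fun i => by simpa using h2 i.castSucc⟩,
      by simpa using h2 (Fin.last m)⟩
  · rintro ⟨⟨h1, h2⟩, h3⟩
    refine ⟨fun i => ?_, fun i => ?_⟩
    · cases i using Fin.lastCases with
      | last =>
        have := h1 (Fin.last m)
        simp only [Fin.val_last] at this ⊢
        push_cast
        exact this.trans h3
      | cast i => simpa using h1 i
    · cases i using Fin.lastCases with
      | last => simpa using h3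
      | cast i => simpa using h2 i

theorem tailSums_one (x : Fin 1 → ℝ) : tailSums 1 x 0 = x 0 := by
  simp [tailSums_apply]

/-- With `S` the sum of the later gaps, the last inequality `S / (m + 1) ≤ (x 0 + S) / (m + 2)`
clears to `S ≤ (m + 1) * x 0`, which is nonnegativity of `excess`. -/
theorem tailSums_mem_L {m : ℕ} {x : Fin (m + 1) → ℝ} :
    tailSums (m + 1) x ∈ L (m + 1) ↔ x ∈ gapCone m := by
  induction m with
  | zero => rw [mem_gapCone_zero, mem_L_one, tailSums_one]
  | succ m ih =>
    have hm : (0 : ℝ) < m + 1 := by positivity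
    rw [mem_gapCone_succ, ← ih, mem_L_succ]
    simp only [tailSums_castSucc]
    refine and_congr_right fun _ => ?_
    rw [tailSums_last, tailSums_last, Fin.sum_univ_succ x, excess_apply,
      div_le_div_iff₀ hm (by positivity)]
    simp only [tailMap_apply]
    push_cast
    constructor <;> intro h <;> linarith

theorem degree_tailSums {m : ℕ} (x : Fin (m + 1) → ℝ) : degree (tailSums (m + 1) x) = x 0 := by
  cases m with
  | zero => simp [degree, gradingVector, tailSums_one]
  | succ m =>
    have h0 : ∀ i : Fin m, gradingVector (m + 2) i.castSucc.castSucc = 0 := fun i => by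
      have := i.isLt
      simp only [gradingVector, Fin.val_castSucc]
      rw [if_neg (by omega), if_neg (by omega)]
    have h1 : gradingVector (m + 2) (Fin.last m).castSucc = -1 := by simp [gradingVector]
    have h2 : gradingVector (m + 2) (Fin.last (m + 1)) = 1 := by simp [gradingVector]
    rw [degree, Fin.sum_univ_castSucc, Fin.sum_univ_castSucc, h1, h2, tailSums_castSucc,
      tailSums_last, tailSums_last, Fin.sum_univ_succ x]
    simp [h0]

theorem L_eq_map (m : ℕ) : L (m + 1) =
    ((gapCone m).map (tailSumsEquiv (m + 1) : (Fin (m + 1) → ℝ) →ₗ[ℝ] (Fin (m + 1) → ℝ)) :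
      Set (Fin (m + 1) → ℝ)) := by
  ext y
  obtain ⟨x, rfl⟩ := (tailSumsEquiv (m + 1)).surjective y
  rw [tailSumsEquiv_apply, tailSums_mem_L]
  constructor
  · exact fun hx => ⟨x, hx, rfl⟩
  · rintro ⟨x', hx', he⟩
    rwa [← (tailSumsEquiv (m + 1)).injective he]

end LectureHall

theorem theorem4p2 (n : ℕ) (hn : 1 ≤ n) :
    LectureHall.HasRegularFlagUnimodularTriangulation (LectureHall.R n) ∧
    ∃ T : LectureHall.SimplicialFan n,
      LectureHall.IsRegularFlagUnimodularConeTriangulation T (LectureHall.L n) ∧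
      ∀ v ∈ T.rayGenerators, LectureHall.degree v = 1 := by
  obtain ⟨m, rfl⟩ := Nat.exists_eq_add_of_le' hn
  obtain ⟨𝓕, w, h⟩ := LectureHall.exists_isGradedTriangulation_gapCone m
  have hL := h.map (LectureHall.tailSumsEquiv (m + 1)) LectureHall.tailSumsEquiv_mem_integerLattice
  refine ⟨?_, hL.fan, ?_, fun v hv => ?_⟩
  · rw [LectureHall.R_eq_slice]
    exact h.hasTriangulation
  · rw [LectureHall.L_eq_map]
    exact hL.fan_isTriangulation
  · have := hL.degree_of_mem_rayGenerators hv
    obtain ⟨x, rfl⟩ := (LectureHall.tailSumsEquiv (m + 1)).surjective v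
    rw [LectureHall.tailSumsEquiv_apply, LectureHall.degree_tailSums]
    simpa using this
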